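/- Let $E$ be an elliptic curve over $\mathbb{Q}$ of conductor $N$ such that $E[2](\mathbb{Q})$ is cyclic of order $2$, let $E' = E/E[2](\mathbb{Q})$ be the quotient curve, and assume condition (Tor): $E[2](\mathbb{Q}) = E'[2](\mathbb{Q}) = \mathbb{Z}/2\mathbb{Z}$. Let $\Delta_E$ and $\Delta_{E'}$ be the discriminants of (any Weierstrass equations over $\mathbb{Q}$ of) $E$ and $E'$. Let $q$ be a prime with $(q,2N)=1$, that is, an odd prime at which $E$ has good reduction, and let $a_q = q+1-\#\widetilde{E}(\mathbb{F}_q)$ be the trace of Frobenius on the reduction $\widetilde{E}$ of $E$ modulo $q$. Then $$ a_q \equiv \begin{cases} 0 \bmod 4 & \text{if } q \equiv 1 \bmod 4 \text{ and } q \text{ is inert in both } \mathbb{Q}(\sqrt{\Delta_E}) \text{ and } \mathbb{Q}(\sqrt{\Delta_{E'}});\\ 0 \bmod 4 & \text{if } q \equiv 3 \bmod 4 \text{ and } q \text{ splits in } \mathbb{Q}(\sqrt{\Delta_E}) \text{ or } \mathbb{Q}(\sqrt{\Delta_{E'}});\\ 2 \bmod 4 & \text{if } q \equiv 1 \bmod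 4 \text{ and } q \text{ splits in } \mathbb{Q}(\sqrt{\Delta_E}) \text{ or } \mathbb{Q}(\sqrt{\Delta_{E'}});\\ 2 \bmod 4 & \text{if } q \equiv 3 \bmod 4 \text{ and } q \text{ is inert in both } \mathbb{Q}(\sqrt{\Delta_E}) \text{ and } \mathbb{Q}(\sqrt{\Delta_{E'}}). \end{cases} $$ Call $q$ admissible for $E$ if $(q,2N)=1$ and $q$ is inert in both quadratic fields $\mathbb{Q}(E[2])$ and $\mathbb{Q}(E'[2])$. Then $q$ is admissible for $E$ if and only if $q$ is inert in both $\mathbb{Q}(\sqrt{\Delta_E})$ and $\mathbb{Q}(\sqrt{\Delta_{E'}})$, and this holds if and only if $$ a_q \equiv 1 - \left(\frac{-1}{q}\right) \bmod 4, $$ where $\left(\frac{\cdot}{q}\right)$ is the Legendre symbol. -/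

import Mathlib

open scoped WeierstrassCurve.Affine

noncomputable section

namespace EllHecke

/-! ### Points of order dividing two, isogenies, quotient curves -/

section Curves

variable {K : Type*} [Field K]

open scoped Classical in
/-- `E[2](F)`: the `F`-rational points of `E` that are killed by `2`. -/
def twoTorsion (E : WeierstrassCurve.Affine K) (F : Type*) [Field F] [Algebra K F] :
    AddSubgroup (E⁄F).Point :=
  AddSubgroup.torsionBy (E⁄F).Point 2

/-- The value at `(x, y)`, with `x, y` in an algebraic closure of `K`, of a polynomial in two
variables over `K` (the inner variable is `X`, the outer one is `Y`). -/
def evalAt (x y : AlgebraicClosure K) (f : Polynomial (Polynomial K)) : AlgebraicClosure K :=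
  Polynomial.evalEval x y
    (f.map (Polynomial.mapRingHom (algebraMap K (AlgebraicClosure K))))

open scoped Classical in
/-- A homomorphism `φ : E(K̄) → E'(K̄)` is an isogeny defined over `K` if it is nonzero and is
given, outside a finite set of points, by rational functions of the coordinates with coefficients
in `K`:  `φ (x, y) = (f₁ (x, y) / g₁ (x, y), f₂ (x, y) / g₂ (x, y))`. (A homomorphism that agrees
with a rational map outside a finite set is a morphism of curves.) -/
def IsIsogeny (E E' : WeierstrassCurve.Affine K)
    (φ : (E⁄(AlgebraicClosure K)).Point →+ (E'⁄(AlgebraicClosure K)).Point) : Prop :=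
  φ ≠ 0 ∧ ∃ f₁ g₁ f₂ g₂ : Polynomial (Polynomial K),
    {P : (E⁄(AlgebraicClosure K)).Point |
      ¬ ∃ (x y : AlgebraicClosure K) (h : (E⁄(AlgebraicClosure K)).Nonsingular x y),
        P = .some x y h ∧ evalAt x y g₁ ≠ 0 ∧ evalAt x y g₂ ≠ 0 ∧
        ∃ h' : (E'⁄(AlgebraicClosure K)).Nonsingular
            (evalAt x y f₁ / evalAt x y g₁) (evalAt x y f₂ / evalAt x y g₂),
          φ P = .some _ _ h'}.Finite

open scoped Classical in
/-- Over a field `K` of characteristic zero: `E'` is the quotient `E / E[2](K)`, that is, `E'` is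
the target of an isogeny over `K` from `E` whose kernel is `E[2](K)`. (In characteristic zero
isogenies are separable, so this determines `E'` up to isomorphism over `K`.) -/
def IsQuotientByRationalTwoTorsion [CharZero K] (E E' : WeierstrassCurve.Affine K) : Prop :=
  ∃ φ : (E⁄(AlgebraicClosure K)).Point →+ (E'⁄(AlgebraicClosure K)).Point,
    IsIsogeny E E' φ ∧
      φ.ker = (twoTorsion E K).map
        (WeierstrassCurve.Affine.Point.baseChange (W' := E) K (AlgebraicClosure K))

end Curves

/-- The condition `E[2](ℚ) = E'[2](ℚ) = ℤ/2ℤ`. -/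
def ConditionTor (E E' : WeierstrassCurve.Affine ℚ) : Prop :=
  Nonempty (twoTorsion E ℚ ≃+ ZMod 2) ∧ Nonempty (twoTorsion E' ℚ ≃+ ZMod 2)

/-! ### Quadratic fields -/

/-- `ℚ(√d)`, inside the algebraic closure of `ℚ`. -/
def sqrtField (d : ℚ) : IntermediateField ℚ (AlgebraicClosure ℚ) :=
  IntermediateField.adjoin ℚ {z | z ^ 2 = algebraMap ℚ (AlgebraicClosure ℚ) d}

open scoped Classical in
/-- `ℚ(E[2])`: the field generated by the coordinates of the points of order two on `E`. -/
def twoDivisionField (E : WeierstrassCurve.Affine ℚ) :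
    IntermediateField ℚ (AlgebraicClosure ℚ) :=
  IntermediateField.adjoin ℚ
    {z | ∃ (x y : AlgebraicClosure ℚ) (h : (E⁄(AlgebraicClosure ℚ)).Nonsingular x y),
      WeierstrassCurve.Affine.Point.some x y h ∈ twoTorsion E (AlgebraicClosure ℚ) ∧
        (z = x ∨ z = y)}

/-- The rational prime `q` is inert in `L`: it generates a prime ideal of the ring of integers. -/
def IsInertIn (q : ℕ) (L : Type*) [Field L] : Prop :=
  (Ideal.span {(q : NumberField.RingOfIntegers L)}).IsPrime

/-- The rational prime `q` splits in the quadratic field `L`: it generates the product of two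
distinct prime ideals of the ring of integers. -/
def SplitsIn (q : ℕ) (L : Type*) [Field L] : Prop :=
  ∃ P Q : Ideal (NumberField.RingOfIntegers L), P.IsPrime ∧ Q.IsPrime ∧ P ≠ Q ∧
    Ideal.span {(q : NumberField.RingOfIntegers L)} = P * Q

/-! ### Reduction modulo `q` -/

section Reduction

variable (E : WeierstrassCurve ℚ) (q : ℕ) [Fact q.Prime]

/-- A minimal Weierstrass equation over `ℤ_q` of the base change of `E` to `ℚ_q`. -/
def minimalAt : WeierstrassCurve ℚ_[q] :=
  (E.baseChange ℚ_[q]).minimal ℤ_[q]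

instance minimalAt_isMinimal : (minimalAt E q).IsMinimal ℤ_[q] :=
  inferInstanceAs (((E.baseChange ℚ_[q]).minimal ℤ_[q]).IsMinimal ℤ_[q])

/-- `E` has good reduction at `q`. -/
def GoodReductionAt : Prop :=
  (minimalAt E q).HasGoodReduction ℤ_[q]

/-- `a_q = q + 1 - #Ẽ(𝔽_q)`, the trace of Frobenius on the reduction `Ẽ` of `E` modulo `q`. -/
def traceOfFrobenius : ℤ :=
  (q : ℤ) + 1 - (Nat.card ((minimalAt E q).reduction ℤ_[q]).toAffine.Point : ℤ)

/-- `q` is admissible for `E` (with quotient curve `E'`): it is an odd prime at which `E` has good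
reduction, that is, prime to `2N` where `N` is the conductor of `E`, and it is inert in both
`ℚ(E[2])` and `ℚ(E'[2])`. -/
def IsAdmissible (E' : WeierstrassCurve ℚ) : Prop :=
  q ≠ 2 ∧ GoodReductionAt E q ∧
    IsInertIn q (twoDivisionField E) ∧ IsInertIn q (twoDivisionField E')

end Reduction

end EllHecke

end

/-!
Let `T = (x₀, y₀)` be the rational point of order two on `E`. Translating `T` to the origin and
completing the square gives the model `Y² = X³ + a X² + b X`, for which `Δ(E) = 16 b² (a² - 4 b)`; the
quantities `b = linCoeff E x₀ y₀` and `4 a = quadCoeff E x₀` are used on arbitrary Weierstrass equations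
instead. A point `P` satisfies `2 P = T` if and only if `(x(P) - x₀)² = b`
(`IsTwoTorsionPt.add_self_eq_iff`).

Over a finite field of odd characteristic this gives the number of points modulo `4`: it is even, and
it is divisible by `4` if and only if `Δ` or `b` is a square
(`IsTwoTorsionPt.four_dvd_card_point_iff`). At an odd prime `q` of good reduction `Δ(E)` and `b` are
units up to squares in `ℚ_q`, so by Hensel's lemma it is equivalent that `Δ(E)` or `b` is a square
in `ℚ_q` (`exists_units_of_goodReduction`).

The quotient `E'` enters through `b · Δ(E')` being a rational square (`isSquare_linCoeff_mul_Δ`).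
The isogeny `φ` is Galois equivariant; the points `P` with `2 P = T` map to two points of order two
on `E'`, and the Galois group exchanges these two exactly when it exchanges the square roots of `b`.
The third point of order two on `E'` is fixed, so `√b` and `√Δ(E')` acquire the same sign.

Finally, for a rational `d` which is not a square and is a unit up to squares in `ℚ_q`, the prime `q` is
inert in `ℚ(√d)` if and only if `d` is not a square in `ℚ_q` (`isInertIn_sqrtField_iff`); a prime cannot both split and be inert, and
`ℚ(E[2]) = ℚ(√Δ(E))` (`twoDivisionField_eq_sqrtField`). Hence `q` is inert in both fields if and only
if the number of points is `2` modulo `4`, and every assertion follows by a computation modulo `4`.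
-/

open scoped WeierstrassCurve.Affine

noncomputable section

namespace EllHecke

/-! ### Points of order two on Weierstrass curves -/

/-- `(x, y)` is an affine point of `W` which equals its own negative: a point of order two. -/
structure IsTwoTorsionPt {R : Type*} [CommRing R] (W : WeierstrassCurve R) (x y : R) : Prop where
  equation : y ^ 2 + W.a₁ * x * y + W.a₃ * y = x ^ 3 + W.a₂ * x ^ 2 + W.a₄ * x + W.a₆
  neg_eq : 2 * y + W.a₁ * x + W.a₃ = 0

/-- The coefficient `b` of the model `Y² = X³ + a X² + b X` obtained from `W` by moving the point
of order two `(x, y)` to the origin. It is minus the partial derivative in `x` of the Weierstrass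
polynomial, which makes sense over any ring. -/
def linCoeff {R : Type*} [CommRing R] (W : WeierstrassCurve R) (x y : R) : R :=
  3 * x ^ 2 + 2 * W.a₂ * x + W.a₄ - W.a₁ * y

/-- The quantity `4 a`, for `a` the quadratic coefficient of the model `Y² = X³ + a X² + b X`
obtained from `W` by moving a point of order two with first coordinate `x` to the origin. -/
def quadCoeff {R : Type*} [CommRing R] (W : WeierstrassCurve R) (x : R) : R :=
  12 * x + W.b₂

lemma linCoeff_map {R S : Type*} [CommRing R] [CommRing S] (W : WeierstrassCurve R) (x y : R)
    (f : R →+* S) : linCoeff (W.map f) (f x) (f y) = f (linCoeff W x y) := by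
  simp [linCoeff, map_ofNat]

namespace IsTwoTorsionPt

section Ring

variable {R S : Type*} [CommRing R] [CommRing S] {W : WeierstrassCurve R} {x y : R}

lemma map (h : IsTwoTorsionPt W x y) (f : R →+* S) : IsTwoTorsionPt (W.map f) (f x) (f y) := by
  constructor
  · simpa using congrArg f h.equation
  · simpa [map_ofNat] using congrArg f h.neg_eq

/-- In the model `Y² = X³ + a X² + b X` this is `Δ = 16 b² (a² - 4 b)`. -/
lemma Δ_eq (h : IsTwoTorsionPt W x y) :
    W.Δ = linCoeff W x y ^ 2 * (quadCoeff W x ^ 2 - 64 * linCoeff W x y) := by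
  have h3 : W.a₃ = -(2 * y + W.a₁ * x) := by linear_combination h.neg_eq
  have h6 : W.a₆ = y ^ 2 + W.a₁ * x * y + W.a₃ * y - (x ^ 3 + W.a₂ * x ^ 2 + W.a₄ * x) := by
    linear_combination -h.equation
  simp only [WeierstrassCurve.Δ, WeierstrassCurve.b₂, WeierstrassCurve.b₄, WeierstrassCurve.b₆,
    WeierstrassCurve.b₈, linCoeff, quadCoeff]
  rw [h6, h3]
  ring

lemma cubic_eq (h : IsTwoTorsionPt W x y) :
    4 * x ^ 3 + W.b₂ * x ^ 2 + 2 * W.b₄ * x + W.b₆ = 0 := by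
  simp only [WeierstrassCurve.b₂, WeierstrassCurve.b₄, WeierstrassCurve.b₆]
  linear_combination (-4) * h.equation + (2 * y + W.a₁ * x + W.a₃) * h.neg_eq

lemma variableChange (h : IsTwoTorsionPt W x y) (C : WeierstrassCurve.VariableChange R) :
    IsTwoTorsionPt (C • W) (C.u⁻¹ ^ 2 * (x - C.r)) (C.u⁻¹ ^ 3 * (y - C.s * (x - C.r) - C.t)) := by
  constructor
  · simp only [WeierstrassCurve.variableChange_def]
    linear_combination (↑C.u⁻¹ : R) ^ 6 * h.equation
  · simp only [WeierstrassCurve.variableChange_def]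
    linear_combination (↑C.u⁻¹ : R) ^ 3 * h.neg_eq

lemma linCoeff_variableChange (h : IsTwoTorsionPt W x y)
    (C : WeierstrassCurve.VariableChange R) :
    linCoeff (C • W) (C.u⁻¹ ^ 2 * (x - C.r)) (C.u⁻¹ ^ 3 * (y - C.s * (x - C.r) - C.t)) =
      C.u⁻¹ ^ 4 * linCoeff W x y := by
  simp only [WeierstrassCurve.variableChange_def, linCoeff]
  linear_combination (↑C.u⁻¹ : R) ^ 4 * (-C.s) * h.neg_eq

lemma linCoeff_ne_zero (h : IsTwoTorsionPt W x y) (hΔ : W.Δ ≠ 0) : linCoeff W x y ≠ 0 := by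
  intro h0
  exact hΔ (by rw [h.Δ_eq, h0]; ring)

end Ring

section Field

variable {F : Type*} [Field F] {W : WeierstrassCurve F} {x₀ y₀ : F}

/-- Two different points of order two have first coordinates related by the quadratic factor of the
`2`-division polynomial. -/
lemma sq_eq_of_ne (h : IsTwoTorsionPt W x₀ y₀) {x y : F} (h' : IsTwoTorsionPt W x y)
    (hx : x ≠ x₀) :
    (8 * (x - x₀) + quadCoeff W x₀) ^ 2 = quadCoeff W x₀ ^ 2 - 64 * linCoeff W x₀ y₀ := by
  have hx' : x - x₀ ≠ 0 := sub_ne_zero.mpr hx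
  refine mul_left_cancel₀ hx' ?_
  have e1 := h.cubic_eq
  have e2 := h'.cubic_eq
  have h3 := h.neg_eq
  simp only [quadCoeff, linCoeff, WeierstrassCurve.b₂, WeierstrassCurve.b₄,
    WeierstrassCurve.b₆] at *
  linear_combination 16 * e2 - 16 * e1 - 32 * W.a₁ * (x - x₀) * h3

/-- Conversely, a root of the quadratic factor of the `2`-division polynomial is the first
coordinate of a point of order two. -/
lemma of_sq_eq (h2 : (2 : F) ≠ 0) (h : IsTwoTorsionPt W x₀ y₀) {x : F}
    (hx : (8 * (x - x₀) + quadCoeff W x₀) ^ 2 = quadCoeff W x₀ ^ 2 - 64 * linCoeff W x₀ y₀) :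
    IsTwoTorsionPt W x (-(W.a₁ * x + W.a₃) / 2) := by
  have e1 := h.cubic_eq
  have h3 := h.neg_eq
  constructor
  · field_simp
    refine mul_left_cancel₀ (pow_ne_zero 4 h2) ?_
    simp only [quadCoeff, linCoeff, WeierstrassCurve.b₂, WeierstrassCurve.b₄,
      WeierstrassCurve.b₆] at *
    linear_combination (-(x - x₀)) * hx - 16 * e1 - 32 * W.a₁ * (x - x₀) * h3
  · field_simp
    ring

lemma nonsingular (h : IsTwoTorsionPt W x₀ y₀) (hΔ : W.Δ ≠ 0) :
    W.toAffine.Nonsingular x₀ y₀ := by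
  have := h.linCoeff_ne_zero hΔ
  rw [WeierstrassCurve.Affine.nonsingular_iff, WeierstrassCurve.Affine.equation_iff]
  refine ⟨h.equation, Or.inl fun h0 ↦ this ?_⟩
  simp only [linCoeff]
  linear_combination -h0

variable [DecidableEq F]

lemma iff_add_self_eq_zero {x y : F} (hns : W.toAffine.Nonsingular x y) :
    IsTwoTorsionPt W x y ↔
      WeierstrassCurve.Affine.Point.some x y hns + .some x y hns = 0 := by
  have heq := (WeierstrassCurve.Affine.equation_iff _ _).mp hns.1
  rw [add_eq_zero_iff_eq_neg, WeierstrassCurve.Affine.Point.neg_some,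
    WeierstrassCurve.Affine.Point.some.injEq, WeierstrassCurve.Affine.negY]
  constructor
  · intro h
    exact ⟨rfl, by linear_combination h.neg_eq⟩
  · rintro ⟨-, h⟩
    exact ⟨heq, by linear_combination h⟩

/-- `2 P = T` means `P + T = -P`, hence that `P` and `P + T` have the same first coordinate; in the
model with `T` at the origin the latter is `b / x`. -/
lemma add_self_eq_iff (h : IsTwoTorsionPt W x₀ y₀) (hΔ : W.Δ ≠ 0)
    (hT : W.toAffine.Nonsingular x₀ y₀) {x y : F} (hP : W.toAffine.Nonsingular x y) :
    WeierstrassCurve.Affine.Point.some x y hP + WeierstrassCurve.Affine.Point.some x y hP =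
      WeierstrassCurve.Affine.Point.some x₀ y₀ hT ↔ (x - x₀) ^ 2 = linCoeff W x₀ y₀ := by
  set P := WeierstrassCurve.Affine.Point.some x y hP with hPdef
  set T := WeierstrassCurve.Affine.Point.some x₀ y₀ hT with hTdef
  have hTT : T + T = 0 := (iff_add_self_eq_zero hT).mp h
  have hnegT : -T = T := by rw [neg_eq_iff_add_eq_zero, hTT]
  have hT0 : T ≠ 0 := WeierstrassCurve.Affine.Point.some_ne_zero hT
  by_cases hx : x = x₀
  · have hPT : P = T := by
      rcases WeierstrassCurve.Affine.Point.X_eq_iff.mp hx with h1 | h1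
      · exact h1
      · rw [hnegT] at h1; exact h1
    rw [hPT, hTT]
    constructor
    · intro h0; exact absurd h0.symm hT0
    · intro h0; rw [hx, sub_self] at h0
      exact absurd (by rw [← h0]; ring) (h.linCoeff_ne_zero hΔ)
  · have hiff : P + P = T ↔ P + T = -P := by
      constructor
      · intro e
        rw [← e, ← add_assoc, eq_neg_iff_add_eq_zero]
        have : P + P + P + P = (P + P) + (P + P) := by abel
        rw [this, e, hTT]
      · intro e
        have : P + P = -T := by
          rw [eq_neg_iff_add_eq_zero]
          have : P + P + T = P + (P + T) := by abel
          rw [this, e, add_neg_cancel]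
        rw [this, hnegT]
    have hxX : P + T ≠ P := by simp [hT0]
    have hd : x - x₀ ≠ 0 := sub_ne_zero.mpr hx
    rw [hiff]
    have hadd := WeierstrassCurve.Affine.Point.add_of_X_ne (h₁ := hP) (h₂ := hT) hx
    have hX : W.toAffine.addX x x₀ (W.toAffine.slope x x₀ y y₀) =
        x₀ + linCoeff W x₀ y₀ / (x - x₀) := by
      rw [WeierstrassCurve.Affine.slope_of_X_ne hx, WeierstrassCurve.Affine.addX]
      have heq := (WeierstrassCurve.Affine.equation_iff _ _).mp hP.1
      have e0 := h.equation
      have h3 := h.neg_eq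
      field_simp
      simp only [linCoeff]
      linear_combination heq - e0 - (y - y₀) * h3
    have key : (P + T = P ∨ P + T = -P) ↔ x₀ + linCoeff W x₀ y₀ / (x - x₀) = x := by
      rw [← hX, hPdef, hTdef, hadd]
      exact WeierstrassCurve.Affine.Point.X_eq_iff.symm
    rw [or_iff_right hxX] at key
    rw [key]
    constructor
    · intro e
      have : linCoeff W x₀ y₀ / (x - x₀) = x - x₀ := by linear_combination e
      rw [div_eq_iff hd] at this
      rw [this]; ring
    · intro e
      rw [← e]
      field_simp
      ring

end Field

end IsTwoTorsionPt

/-! ### The number of points over a finite field modulo four -/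

/-- Divisibility by `4` of the order of a finite commutative group with an element `T` of order two:
by Cauchy's theorem in the quotient by `⟨T⟩`, it amounts to an element outside `⟨T⟩` whose double
lies in `⟨T⟩`. -/
lemma four_dvd_card_iff {G : Type*} [AddCommGroup G] [Finite G] {T : G} (hT : T ≠ 0)
    (hTT : T + T = 0) :
    2 ∣ Nat.card G ∧
      (4 ∣ Nat.card G ↔ ∃ P : G, P ≠ 0 ∧ P ≠ T ∧ (P + P = 0 ∨ P + P = T)) := by
  set H := AddSubgroup.zmultiples T with hH
  have hmem : ∀ g : G, g ∈ H ↔ g = 0 ∨ g = T := by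
    intro g
    rw [hH, AddSubgroup.mem_zmultiples_iff]
    constructor
    · rintro ⟨k, rfl⟩
      rcases Int.even_or_odd' k with ⟨m, rfl | rfl⟩
      · left
        rw [mul_comm, mul_smul, two_smul, hTT, smul_zero]
      · right
        rw [add_smul, mul_comm, mul_smul, two_smul, hTT, smul_zero, one_smul, zero_add]
    · rintro (rfl | rfl)
      · exact ⟨0, by simp⟩
      · exact ⟨1, by simp⟩
  have hcard : Nat.card H = 2 := by
    rw [hH, Nat.card_zmultiples]
    exact addOrderOf_eq_prime (by rw [two_smul, hTT]) hT
  have hG := AddSubgroup.card_eq_card_quotient_mul_card_addSubgroup H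
  rw [hcard] at hG
  refine ⟨⟨_, by rw [hG, mul_comm]⟩, ?_⟩
  have h42 : 4 ∣ Nat.card G ↔ 2 ∣ Nat.card (G ⧸ H) := by rw [hG]; omega
  rw [h42]
  constructor
  · intro h
    obtain ⟨z, hz⟩ := exists_prime_addOrderOf_dvd_card' (G := G ⧸ H) 2 h
    obtain ⟨P, rfl⟩ := QuotientAddGroup.mk_surjective z
    have hP : P ∉ H := by
      intro hP
      rw [(QuotientAddGroup.eq_zero_iff P).mpr hP, addOrderOf_zero] at hz
      omega
    have h2P : P + P ∈ H := by
      rw [← QuotientAddGroup.eq_zero_iff, QuotientAddGroup.mk_add, ← two_nsmul, ← hz,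
        addOrderOf_nsmul_eq_zero]
    rw [hmem, not_or] at hP
    exact ⟨P, hP.1, hP.2, (hmem _).mp h2P⟩
  · rintro ⟨P, h0, h1, h2⟩
    have hz : addOrderOf (P : G ⧸ H) = 2 := by
      refine addOrderOf_eq_prime ?_ ?_
      · rw [two_nsmul, ← QuotientAddGroup.mk_add, QuotientAddGroup.eq_zero_iff, hmem]
        exact h2
      · rw [Ne, QuotientAddGroup.eq_zero_iff, hmem]
        tauto
    rw [← hz]
    exact addOrderOf_dvd_natCard _

lemma isSquare_or_isSquare_of_mul {F : Type*} [Field F] [Finite F] (h2 : (2 : F) ≠ 0) {u v : F}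
    (h : ¬ IsSquare (u * v)) : IsSquare u ∨ IsSquare v := by
  classical
  have := Fintype.ofFinite F
  have hF : ringChar F ≠ 2 := fun e ↦ h2 (by
    have := ringChar.spec F 2
    rw [e] at this
    simpa using this.mpr dvd_rfl)
  by_contra hcon
  rw [not_or] at hcon
  have hu := quadraticChar_neg_one_iff_not_isSquare.mpr hcon.1
  have hv := quadraticChar_neg_one_iff_not_isSquare.mpr hcon.2
  have huv : quadraticChar F (u * v) = 1 := by rw [map_mul, hu, hv]; norm_num
  refine h ((quadraticChar_one_iff_isSquare ?_).mp huv)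
  intro h0
  rw [h0, MulChar.map_zero] at huv
  exact zero_ne_one huv

instance finite_point {F : Type*} [Field F] [Finite F] (W : WeierstrassCurve.Affine F) :
    Finite W.Point := by
  refine Finite.of_injective
    (fun P : W.Point ↦ (match P with
      | .zero => none
      | .some x y _ => some (x, y) : Option (F × F))) ?_
  rintro (_ | ⟨x, y, h⟩) (_ | ⟨x', y', h'⟩) e <;> simp_all

/-- Over a finite field of odd characteristic, let `T = (x₀, y₀)` be a point of order two of `W`.
The number of points of `W` is divisible by `4` exactly if there is a second point of order two,
that is, `Δ` is a square, or a point `P` with `2 P = T`, which forces `b` to be a square. If `b` is a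
square and `Δ` is not, then exactly one of the two values `x₀ ± √b` is the first coordinate of a
rational point. -/
theorem IsTwoTorsionPt.four_dvd_card_point_iff {F : Type*} [Field F] [Finite F]
    (h2 : (2 : F) ≠ 0) {W : WeierstrassCurve F} (hΔ : W.Δ ≠ 0) {x₀ y₀ : F}
    (h : IsTwoTorsionPt W x₀ y₀) :
    2 ∣ Nat.card W.toAffine.Point ∧
      (4 ∣ Nat.card W.toAffine.Point ↔ IsSquare W.Δ ∨ IsSquare (linCoeff W x₀ y₀)) := by
  classical
  have hT := h.nonsingular hΔ
  have hT0 : WeierstrassCurve.Affine.Point.some x₀ y₀ hT ≠ 0 :=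
    WeierstrassCurve.Affine.Point.some_ne_zero hT
  have hTT := (iff_add_self_eq_zero hT).mp h
  have hb := h.linCoeff_ne_zero hΔ
  have h8 : (8 : F) ≠ 0 := by
    have : (8 : F) = 2 ^ 3 := by norm_num
    rw [this]; exact pow_ne_zero _ h2
  obtain ⟨hdvd, hiff⟩ := four_dvd_card_iff hT0 hTT
  refine ⟨hdvd, hiff.trans ⟨?_, ?_⟩⟩
  · rintro ⟨P, hP0, hPT, hP⟩
    rcases P with _ | ⟨x, y, hxy⟩
    · exact absurd rfl hP0
    rcases hP with hP | hP
    · left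
      have h' := (iff_add_self_eq_zero hxy).mpr hP
      have hx : x ≠ x₀ := by
        intro e
        rcases (WeierstrassCurve.Affine.Point.X_eq_iff (h₁ := hxy) (h₂ := hT)).mp e with e | e
        · exact hPT e
        · rw [neg_eq_of_add_eq_zero_left hTT] at e
          exact hPT e
      rw [h.Δ_eq, ← h.sq_eq_of_ne h' hx, ← mul_pow]
      exact IsSquare.sq _
    · right
      rw [← (h.add_self_eq_iff hΔ hT hxy).mp hP]
      exact IsSquare.sq _
  · intro hsq
    by_cases hsΔ : IsSquare W.Δ
    · obtain ⟨r, hr⟩ := hsΔ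
      set δ := r / linCoeff W x₀ y₀ with hδ
      have hδ2 : δ ^ 2 = quadCoeff W x₀ ^ 2 - 64 * linCoeff W x₀ y₀ := by
        have := h.Δ_eq
        rw [hδ, div_pow, pow_two r, ← hr, this]
        field_simp
      set x := x₀ + (δ - quadCoeff W x₀) / 8 with hx
      have hx8 : 8 * (x - x₀) + quadCoeff W x₀ = δ := by
        rw [hx]; field_simp; ring
      have h' := h.of_sq_eq h2 (x := x) (by rw [hx8, hδ2])
      have hxne : x ≠ x₀ := by
        intro e
        rw [e, sub_self, mul_zero, zero_add] at hx8
        rw [← hx8] at hδ2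
        have h64 : 64 * linCoeff W x₀ y₀ = 8 * 8 * linCoeff W x₀ y₀ := by ring
        have : 8 * 8 * linCoeff W x₀ y₀ = 0 := by rw [← h64]; linear_combination hδ2
        exact mul_ne_zero (mul_ne_zero h8 h8) hb this
      have hns := h'.nonsingular hΔ
      refine ⟨.some _ _ hns, WeierstrassCurve.Affine.Point.some_ne_zero hns, ?_,
        Or.inl ((iff_add_self_eq_zero hns).mp h')⟩
      intro e
      rw [WeierstrassCurve.Affine.Point.some.injEq] at e
      exact hxne e.1
    · obtain ⟨β, hβ⟩ := hsq.resolve_left hsΔ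
      -- a square root of `A + 8 β` yields a point with first coordinate `x₀ + β`
      have hpt : ∀ β : F, linCoeff W x₀ y₀ = β * β → IsSquare (quadCoeff W x₀ + 8 * β) →
          ∃ P : W.toAffine.Point, P ≠ 0 ∧ P ≠ .some x₀ y₀ hT ∧
            (P + P = 0 ∨ P + P = .some x₀ y₀ hT) := by
        rintro β hβ ⟨s, hs⟩
        have hβ0 : β ≠ 0 := by rintro rfl; exact hb (by rw [hβ, zero_mul])
        set x := x₀ + β with hx
        set y := (β * s - (W.a₁ * x + W.a₃)) / 2 with hy
        have hEq : W.toAffine.Equation x y := by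
          rw [WeierstrassCurve.Affine.equation_iff]
          have hy2 : 2 * y = β * s - (W.a₁ * x + W.a₃) := by rw [hy]; field_simp
          refine mul_left_cancel₀ (pow_ne_zero 2 h2) ?_
          have e1 := h.cubic_eq
          have h3 := h.neg_eq
          have hlin : linCoeff W x₀ y₀ - β * β = 0 := by rw [hβ, sub_self]
          have hs' : s * s = 12 * x₀ + W.b₂ + 8 * β := hs.symm
          simp only [linCoeff, WeierstrassCurve.b₂, WeierstrassCurve.b₄,
            WeierstrassCurve.b₆] at e1 h3 hlin hs'
          rw [hx] at hy2 ⊢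
          linear_combination (2 * y + W.a₁ * (x₀ + β) + W.a₃ + β * s) * hy2 + β ^ 2 * hs'
            - e1 - 2 * W.a₁ * β * h3 - 4 * β * hlin
        have hns : W.toAffine.Nonsingular x y :=
          (WeierstrassCurve.Affine.equation_iff_nonsingular_of_Δ_ne_zero hΔ).mp hEq
        refine ⟨.some x y hns, WeierstrassCurve.Affine.Point.some_ne_zero hns, ?_, Or.inr ?_⟩
        · intro e
          rw [WeierstrassCurve.Affine.Point.some.injEq] at e
          exact hβ0 (by simpa [hx] using e.1)
        · rw [h.add_self_eq_iff hΔ hT hns, hβ, hx]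
          ring
      have hprod : ¬ IsSquare ((quadCoeff W x₀ + 8 * β) * (quadCoeff W x₀ + 8 * -β)) := by
        intro hs
        refine hsΔ ?_
        rw [h.Δ_eq]
        have : quadCoeff W x₀ ^ 2 - 64 * linCoeff W x₀ y₀ =
            (quadCoeff W x₀ + 8 * β) * (quadCoeff W x₀ + 8 * -β) := by rw [hβ]; ring
        rw [this]
        exact (IsSquare.sq _).mul hs
      rcases isSquare_or_isSquare_of_mul h2 hprod with hs | hs
      · exact hpt β hβ hs
      · exact hpt (-β) (by rw [hβ]; ring) hs

/-! ### Galois equivariance and the discriminant of the quotient curve -/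

/-- Two homomorphisms on an infinite group which agree outside a finite set are equal, because a
subgroup with finite complement is everything. -/
lemma addMonoidHom_eq_of_finite_ne {G H : Type*} [AddGroup G] [AddGroup H] [Infinite G]
    {f g : G →+ H} (hfin : {x | f x ≠ g x}.Finite) : f = g := by
  ext x
  by_contra hx
  have hmem : ∀ y, y ∈ f.eqLocus g ↔ f y = g y := fun y ↦ Iff.rfl
  have h1 : ((f.eqLocus g : AddSubgroup G) : Set G).Finite := by
    refine Set.Finite.of_finite_image (f := fun y ↦ x + y) (hfin.subset ?_)
      (add_right_injective x).injOn
    rintro _ ⟨y, hy, rfl⟩ e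
    have hy' : f y = g y := hy
    rw [map_add, map_add, hy'] at e
    exact hx (add_right_cancel e)
  refine Set.infinite_univ (α := G) ((h1.union hfin).subset fun y _ ↦ ?_)
  by_cases hy : f y = g y
  · exact Or.inl hy
  · exact Or.inr hy

lemma exists_equation {F : Type*} [Field F] [IsAlgClosed F] (h2 : (2 : F) ≠ 0)
    (W : WeierstrassCurve F) (x : F) : ∃ y, W.toAffine.Equation x y := by
  obtain ⟨s, hs⟩ := IsAlgClosed.exists_pow_nat_eq
    (4 * x ^ 3 + W.b₂ * x ^ 2 + 2 * W.b₄ * x + W.b₆) (n := 2) (by norm_num)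
  refine ⟨(s - (W.a₁ * x + W.a₃)) / 2, ?_⟩
  rw [WeierstrassCurve.Affine.equation_iff]
  refine mul_left_cancel₀ (pow_ne_zero 2 h2) ?_
  simp only [WeierstrassCurve.b₂, WeierstrassCurve.b₄, WeierstrassCurve.b₆] at hs
  field_simp
  linear_combination hs

lemma infinite_point {F : Type*} [Field F] [IsAlgClosed F] (h2 : (2 : F) ≠ 0)
    {W : WeierstrassCurve F} (hΔ : W.Δ ≠ 0) : Infinite W.toAffine.Point := by
  have := IsAlgClosed.instInfinite (K := F)
  choose y hy using exists_equation h2 W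
  refine Infinite.of_injective (fun x : F ↦ WeierstrassCurve.Affine.Point.some x (y x)
    ((WeierstrassCurve.Affine.equation_iff_nonsingular_of_Δ_ne_zero hΔ).mp (hy x))) ?_
  intro x x' e
  simp only [WeierstrassCurve.Affine.Point.some.injEq] at e
  exact e.1

section Curves

variable {K : Type*} [Field K]

lemma evalAt_algEquiv (σ : AlgebraicClosure K ≃ₐ[K] AlgebraicClosure K)
    (x y : AlgebraicClosure K) (f : Polynomial (Polynomial K)) :
    evalAt (σ x) (σ y) f = σ (evalAt x y f) := by
  have h := Polynomial.map_mapRingHom_evalEval (σ : AlgebraicClosure K →+* AlgebraicClosure K)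
    (f.map (Polynomial.mapRingHom (algebraMap K (AlgebraicClosure K)))) x y
  rw [Polynomial.map_map, Polynomial.mapRingHom_comp] at h
  have hσ : (σ : AlgebraicClosure K →+* AlgebraicClosure K).comp
      (algebraMap K (AlgebraicClosure K)) = algebraMap K (AlgebraicClosure K) := by
    ext z
    simp
  rw [hσ] at h
  exact h

lemma baseChange_Δ_ne_zero (E : WeierstrassCurve K) [E.IsElliptic] (F : Type*) [Field F]
    [Algebra K F] : (E.baseChange F).Δ ≠ 0 := by
  rw [WeierstrassCurve.baseChange, WeierstrassCurve.map_Δ]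
  simpa using E.isUnit_Δ.ne_zero

open scoped Classical in
/-- The action of an automorphism of the algebraic closure on the points of a curve over `K`. -/
def galoisAct (E : WeierstrassCurve.Affine K) (σ : AlgebraicClosure K ≃ₐ[K] AlgebraicClosure K) :
    (E⁄(AlgebraicClosure K)).Point →+ (E⁄(AlgebraicClosure K)).Point :=
  WeierstrassCurve.Affine.Point.map (W' := E) (σ : AlgebraicClosure K →ₐ[K] AlgebraicClosure K)

lemma nonsingular_galois {E : WeierstrassCurve.Affine K}
    (σ : AlgebraicClosure K ≃ₐ[K] AlgebraicClosure K) {x y : AlgebraicClosure K}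
    (h : (E⁄(AlgebraicClosure K)).Nonsingular x y) :
    (E⁄(AlgebraicClosure K)).Nonsingular (σ x) (σ y) :=
  (E.baseChange_nonsingular (f := (σ : AlgebraicClosure K →ₐ[K] AlgebraicClosure K))
    σ.injective ..).mpr h

open scoped Classical in
lemma galoisAct_some (E : WeierstrassCurve.Affine K)
    (σ : AlgebraicClosure K ≃ₐ[K] AlgebraicClosure K) {x y : AlgebraicClosure K}
    (h : (E⁄(AlgebraicClosure K)).Nonsingular x y) :
    galoisAct E σ (.some x y h) = .some (σ x) (σ y) (nonsingular_galois σ h) :=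
  rfl

open scoped Classical in
lemma galoisAct_injective (E : WeierstrassCurve.Affine K)
    (σ : AlgebraicClosure K ≃ₐ[K] AlgebraicClosure K) :
    Function.Injective (galoisAct E σ) :=
  WeierstrassCurve.Affine.Point.map_injective _

open scoped Classical in
/-- An isogeny over `K` commutes with the Galois action: this is clear where it is given by rational
functions over `K`, and a homomorphism is determined outside a finite set. -/
lemma IsIsogeny.comp_galoisAct [CharZero K] {E E' : WeierstrassCurve K} [E.IsElliptic]
    {φ : (E.toAffine⁄(AlgebraicClosure K)).Point →+ (E'.toAffine⁄(AlgebraicClosure K)).Point}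
    (hφ : IsIsogeny E E' φ) (σ : AlgebraicClosure K ≃ₐ[K] AlgebraicClosure K)
    (P : (E.toAffine⁄(AlgebraicClosure K)).Point) :
    φ (galoisAct E σ P) = galoisAct E' σ (φ P) := by
  obtain ⟨-, f₁, g₁, f₂, g₂, hfin⟩ := hφ
  have h2 : (2 : AlgebraicClosure K) ≠ 0 := by
    have : CharZero (AlgebraicClosure K) :=
      charZero_of_injective_algebraMap (algebraMap K (AlgebraicClosure K)).injective
    exact two_ne_zero
  have := infinite_point h2 (baseChange_Δ_ne_zero E (AlgebraicClosure K))
  have key : φ.comp (galoisAct E σ) = (galoisAct E' σ).comp φ := by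
    refine addMonoidHom_eq_of_finite_ne
      ((hfin.union (hfin.preimage (galoisAct_injective E σ).injOn)).subset ?_)
    intro P hP
    by_contra hcon
    rw [Set.mem_union, not_or] at hcon
    obtain ⟨h1, h1'⟩ := hcon
    rw [Set.mem_ofPred_eq, not_not] at h1
    rw [Set.mem_preimage, Set.mem_ofPred_eq, not_not] at h1'
    obtain ⟨x, y, h, rfl, hg1, hg2, h', hφP⟩ := h1
    obtain ⟨x', y', hxy', e, -, -, h'', hφP'⟩ := h1'
    refine hP ?_
    rw [galoisAct_some, WeierstrassCurve.Affine.Point.some.injEq] at e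
    obtain ⟨rfl, rfl⟩ := e
    rw [AddMonoidHom.comp_apply, AddMonoidHom.comp_apply, hφP', hφP, galoisAct_some,
      WeierstrassCurve.Affine.Point.some.injEq]
    simp only [evalAt_algEquiv, map_div₀, and_self]
  exact DFunLike.congr_fun key P

open scoped Classical in
/-- If there is just one rational point of order two, its coordinates and the fact that it is the
only one. -/
lemma exists_twoTorsion_eq {E : WeierstrassCurve K} (h : Nonempty (twoTorsion E K ≃+ ZMod 2)) :
    ∃ (x₀ y₀ : K) (hns : (E.toAffine⁄K).Nonsingular x₀ y₀), IsTwoTorsionPt E x₀ y₀ ∧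
      ∀ P : (E.toAffine⁄K).Point, P ∈ twoTorsion E K ↔ P = 0 ∨ P = .some x₀ y₀ hns := by
  obtain ⟨e⟩ := h
  have hdic : ∀ z : ZMod 2, z = 0 ∨ z = 1 := by decide
  have hmem : ∀ P : (E.toAffine⁄K).Point, P ∈ twoTorsion E K ↔
      P = 0 ∨ P = (e.symm 1 : twoTorsion E K) := by
    intro P
    constructor
    · intro hP
      rcases hdic (e ⟨P, hP⟩) with h | h
      · left
        rw [map_eq_zero_iff e e.injective] at h
        exact congrArg Subtype.val h
      · right
        rw [← h, AddEquiv.symm_apply_apply]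
    · rintro (rfl | rfl)
      · exact zero_mem _
      · exact Subtype.property _
  have hne : ((e.symm 1 : twoTorsion E K) : (E.toAffine⁄K).Point) ≠ 0 := by
    intro h0
    have : (e.symm 1 : twoTorsion E K) = 0 := Subtype.ext h0
    rw [map_eq_zero_iff e.symm e.symm.injective] at this
    exact one_ne_zero this
  have hT := (e.symm 1 : twoTorsion E K).2
  generalize ((e.symm 1 : twoTorsion E K) : (E.toAffine⁄K).Point) = T at hmem hne hT
  rcases T with _ | ⟨x₀, y₀, hns⟩
  · exact absurd rfl hne
  refine ⟨x₀, y₀, hns, ?_, hmem⟩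
  have h2 : (2 : ℤ) • WeierstrassCurve.Affine.Point.some x₀ y₀ hns = 0 := by
    simpa [twoTorsion] using hT
  rw [two_smul] at h2
  have hE : E.baseChange K = E := WeierstrassCurve.map_id E
  have := (IsTwoTorsionPt.iff_add_self_eq_zero hns).mpr h2
  rwa [hE] at this

/-- If `X₁ ≠ X₂` are first coordinates of points of order two, the third one is determined by the
trace of the `2`-division polynomial, and `Δ` is `16` times the square of the Vandermonde product. -/
lemma Δ_eq_of_two_roots {F : Type*} [Field F] (h2 : (2 : F) ≠ 0) {W : WeierstrassCurve F}
    {X₁ X₂ : F} (hne : X₁ ≠ X₂)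
    (h₁ : 4 * X₁ ^ 3 + W.b₂ * X₁ ^ 2 + 2 * W.b₄ * X₁ + W.b₆ = 0)
    (h₂ : 4 * X₂ ^ 3 + W.b₂ * X₂ ^ 2 + 2 * W.b₄ * X₂ + W.b₆ = 0) :
    W.Δ = (4 * ((-W.b₂ / 4 - X₁ - X₂ - X₁) * (-W.b₂ / 4 - X₁ - X₂ - X₂) * (X₁ - X₂))) ^ 2 := by
  have h4 : (4 : F) ≠ 0 := by
    have : (4 : F) = 2 ^ 2 := by norm_num
    rw [this]; exact pow_ne_zero _ h2
  set X₀ := -W.b₂ / 4 - X₁ - X₂ with hX0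
  have e2 : W.b₂ = -4 * (X₀ + X₁ + X₂) := by
    rw [hX0]; field_simp; ring
  have e4 : W.b₄ = 2 * (X₀ * X₁ + X₀ * X₂ + X₁ * X₂) := by
    refine mul_left_cancel₀ (mul_ne_zero h2 (sub_ne_zero.mpr hne)) ?_
    rw [e2] at h₁ h₂
    linear_combination h₁ - h₂
  have e6 : W.b₆ = -4 * (X₀ * X₁ * X₂) := by
    rw [e2, e4] at h₁
    linear_combination h₁
  have e8 : W.b₈ = (W.b₂ * W.b₆ - W.b₄ ^ 2) / 4 := by
    rw [← W.b_relation]; field_simp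
  rw [WeierstrassCurve.Δ, e8, e2, e4, e6]
  field_simp
  ring

open scoped Classical in
/-- Let `T` be the rational point of order two and `b` the associated coefficient. The images under
`E → E / ⟨T⟩` of the two classes of points `P` with `2 P = T`, which have first coordinate
`x(T) ± √b`, are two points of order two on the quotient. The Galois group permutes them as it
permutes `±√b`, so that `√b · √Δ(E')` is rational. -/
theorem isSquare_linCoeff_mul_Δ [CharZero K] {E E' : WeierstrassCurve K} [E.IsElliptic]
    (hquot : IsQuotientByRationalTwoTorsion E E') {x₀ y₀ : K}
    (hns : (E.toAffine⁄K).Nonsingular x₀ y₀) (hT : IsTwoTorsionPt E x₀ y₀)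
    (huniq : ∀ P : (E.toAffine⁄K).Point, P ∈ twoTorsion E K ↔ P = 0 ∨ P = .some x₀ y₀ hns) :
    IsSquare (linCoeff E x₀ y₀ * E'.Δ) := by
  obtain ⟨φ, hφ, hker⟩ := hquot
  set F := AlgebraicClosure K
  have : CharZero F := charZero_of_injective_algebraMap (algebraMap K F).injective
  have h2 : (2 : F) ≠ 0 := two_ne_zero
  have hΔ := baseChange_Δ_ne_zero E F
  have hTF : IsTwoTorsionPt (E.baseChange F) (algebraMap K F x₀) (algebraMap K F y₀) :=
    hT.map (algebraMap K F)
  have hnsF := hTF.nonsingular hΔ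
  have hb := linCoeff_map E x₀ y₀ (algebraMap K F)
  change linCoeff (E.baseChange F) _ _ = _ at hb
  -- the kernel of `φ` is `{0, T}`
  have hkermem : ∀ P : (E.toAffine⁄F).Point, φ P = 0 ↔ P = 0 ∨ P = .some _ _ hnsF := by
    intro P
    rw [← AddMonoidHom.mem_ker, hker, AddSubgroup.mem_map]
    constructor
    · rintro ⟨Q, hQ, rfl⟩
      rcases (huniq Q).mp hQ with rfl | rfl
      · left; exact map_zero _
      · right; rfl
    · rintro (rfl | rfl)
      · exact ⟨0, zero_mem _, map_zero _⟩
      · exact ⟨.some x₀ y₀ hns, (huniq _).mpr (Or.inr rfl), rfl⟩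
  have hTT := (IsTwoTorsionPt.iff_add_self_eq_zero hnsF).mp hTF
  have hT0 : WeierstrassCurve.Affine.Point.some _ _ hnsF ≠ 0 :=
    WeierstrassCurve.Affine.Point.some_ne_zero hnsF
  have hφT := (hkermem _).mpr (Or.inr rfl)
  obtain ⟨β, hβ⟩ := IsAlgClosed.exists_pow_nat_eq (algebraMap K F (linCoeff E x₀ y₀)) (n := 2)
    (by norm_num)
  have hβ0 : β ≠ 0 := by
    rintro rfl
    exact hTF.linCoeff_ne_zero hΔ (by rw [hb, ← hβ]; ring)
  -- the image of a point over `x₀ + γ`, where `γ² = b`, has order two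
  have himg : ∀ γ : F, γ ^ 2 = algebraMap K F (linCoeff E x₀ y₀) →
      ∃ (y X Y : F) (h : (E.toAffine⁄F).Nonsingular (algebraMap K F x₀ + γ) y)
        (h' : (E'.toAffine⁄F).Nonsingular X Y), φ (.some _ _ h) = .some X Y h' ∧
          IsTwoTorsionPt (E'.baseChange F) X Y ∧
          WeierstrassCurve.Affine.Point.some _ _ h + .some _ _ h = .some _ _ hnsF := by
    intro γ hγ
    obtain ⟨y, hy⟩ := exists_equation h2 (E.baseChange F) (algebraMap K F x₀ + γ)
    have h : (E.toAffine⁄F).Nonsingular (algebraMap K F x₀ + γ) y :=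
      (WeierstrassCurve.Affine.equation_iff_nonsingular_of_Δ_ne_zero hΔ).mp hy
    have h2P := (hTF.add_self_eq_iff hΔ hnsF h).mpr (by rw [hb, ← hγ]; ring)
    have hne : φ (.some _ _ h) ≠ 0 := by
      rw [Ne, hkermem]
      rintro (e | e)
      · exact WeierstrassCurve.Affine.Point.some_ne_zero h e
      · rw [e, hTT] at h2P
        exact hT0 h2P.symm
    have h2Q : φ (.some _ _ h) + φ (.some _ _ h) = 0 := by rw [← map_add, h2P, hφT]
    rcases hQ : φ (.some _ _ h) with _ | ⟨X, Y, h'⟩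
    · exact absurd hQ hne
    · rw [hQ] at h2Q
      exact ⟨y, X, Y, h, h', hQ, (IsTwoTorsionPt.iff_add_self_eq_zero h').mpr h2Q, h2P⟩
  -- points with `2 P = T` and the same first coordinate have the same image
  have hsame : ∀ {x y y' : F} (h : (E.toAffine⁄F).Nonsingular x y)
      (h' : (E.toAffine⁄F).Nonsingular x y'),
      WeierstrassCurve.Affine.Point.some _ _ h + .some _ _ h = .some _ _ hnsF →
      φ (.some _ _ h') = φ (.some _ _ h) := by
    intro x y y' h h' h2P
    rcases (WeierstrassCurve.Affine.Point.X_eq_iff (h₁ := h') (h₂ := h)).mp rfl with e | e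
    · rw [e]
    · rw [e, map_neg, neg_eq_iff_add_eq_zero, ← map_add, h2P, hφT]
  obtain ⟨y₁, X₁, Y₁, h₁, h₁', hφ₁, ht₁, h2₁⟩ := himg β hβ
  obtain ⟨y₂, X₂, Y₂, h₂, h₂', hφ₂, ht₂, h2₂⟩ := himg (-β) (by rw [neg_sq, hβ])
  have hX : X₁ ≠ X₂ := by
    intro e
    have hxne : algebraMap K F x₀ + β ≠ algebraMap K F x₀ + -β := by
      intro e
      have : 2 * β = 0 := by linear_combination e
      exact mul_ne_zero h2 hβ0 this
    have hneg : φ (.some _ _ h₂) = φ (.some _ _ h₁) := by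
      rw [hφ₁, hφ₂]
      rcases (WeierstrassCurve.Affine.Point.X_eq_iff (h₁ := h₁') (h₂ := h₂')).mp e with e | e
      · exact e.symm
      · rw [e, ← add_eq_zero_iff_eq_neg]
        exact (IsTwoTorsionPt.iff_add_self_eq_zero h₂').mp ht₂
    rw [← sub_eq_zero, ← map_sub, hkermem] at hneg
    rcases hneg with e | e
    · rw [sub_eq_zero, WeierstrassCurve.Affine.Point.some.injEq] at e
      exact hxne e.1.symm
    · rw [sub_eq_iff_eq_add, ← h2₁, add_assoc] at e
      have : WeierstrassCurve.Affine.Point.some _ _ h₂ = -.some _ _ h₁ := by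
        have h3 : WeierstrassCurve.Affine.Point.some _ _ h₁ + .some _ _ h₁ + .some _ _ h₁
            + .some _ _ h₁ = 0 := by
          rw [h2₁, add_assoc, h2₁, hTT]
        rw [e, eq_neg_iff_add_eq_zero, ← h3]
        abel
      exact hxne (WeierstrassCurve.Affine.Point.X_eq_iff.mpr (Or.inr this)).symm
  have hΔ' := Δ_eq_of_two_roots h2 hX ht₁.cubic_eq ht₂.cubic_eq
  set δ := 4 * ((-(E'.baseChange F).b₂ / 4 - X₁ - X₂ - X₁) *
    (-(E'.baseChange F).b₂ / 4 - X₁ - X₂ - X₂) * (X₁ - X₂)) with hδ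
  have hb2 : (E'.baseChange F).b₂ = algebraMap K F E'.b₂ := by
    rw [WeierstrassCurve.baseChange, WeierstrassCurve.map_b₂]
  have hfix : ∀ σ : F ≃ₐ[K] F, σ (β * δ) = β * δ := by
    intro σ
    have hσb : σ (-(E'.baseChange F).b₂ / 4) = -(E'.baseChange F).b₂ / 4 := by
      rw [hb2, map_div₀, map_neg, AlgEquiv.commutes, map_ofNat]
    have hσβ : σ β = β ∨ σ β = -β := by
      rw [← sq_eq_sq_iff_eq_or_eq_neg, ← map_pow, hβ, AlgEquiv.commutes]
    -- `σ` acts on the images as on the first coordinates of the points `P`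
    have hact : ∀ {γ γ' y y' X Y X' Y' : F}
        (h : (E.toAffine⁄F).Nonsingular (algebraMap K F x₀ + γ) y)
        (h' : (E.toAffine⁄F).Nonsingular (algebraMap K F x₀ + γ') y')
        (k : (E'.toAffine⁄F).Nonsingular X Y) (k' : (E'.toAffine⁄F).Nonsingular X' Y'),
        WeierstrassCurve.Affine.Point.some _ _ h' + .some _ _ h' = .some _ _ hnsF →
        φ (.some _ _ h) = .some _ _ k → φ (.some _ _ h') = .some _ _ k' → σ γ = γ' →
        σ X = X' := by
      intro γ γ' y y' X Y X' Y' h h' k k' h2P e e' hγ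
      have hcomm := hφ.comp_galoisAct σ (.some _ _ h)
      have hx : σ (algebraMap K F x₀ + γ) = algebraMap K F x₀ + γ' := by
        rw [map_add, AlgEquiv.commutes, hγ]
      rw [e, galoisAct_some, galoisAct_some] at hcomm
      simp only [hx] at hcomm
      rw [hsame h' _ h2P, e', WeierstrassCurve.Affine.Point.some.injEq] at hcomm
      exact hcomm.1.symm
    rcases hσβ with hs | hs
    · have e1 : σ X₁ = X₁ := hact h₁ h₁ h₁' h₁' h2₁ hφ₁ hφ₁ hs
      have e2 : σ X₂ = X₂ := hact h₂ h₂ h₂' h₂' h2₂ hφ₂ hφ₂ (by rw [map_neg, hs])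
      rw [hδ]
      simp only [map_mul, map_sub, map_ofNat, hσb, hs, e1, e2]
    · have e1 : σ X₁ = X₂ := hact h₁ h₂ h₁' h₂' h2₂ hφ₁ hφ₂ hs
      have e2 : σ X₂ = X₁ := hact h₂ h₁ h₂' h₁' h2₁ hφ₂ hφ₁ (by rw [map_neg, hs, neg_neg])
      rw [hδ]
      simp only [map_mul, map_sub, map_ofNat, hσb, hs, e1, e2]
      ring
  obtain ⟨r, hr⟩ := (InfiniteGalois.mem_range_algebraMap_iff_fixed (β * δ)).mpr hfix
  refine ⟨r, (algebraMap K F).injective ?_⟩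
  have hΔ'' : algebraMap K F E'.Δ = δ ^ 2 := by
    rw [← hΔ', WeierstrassCurve.baseChange, WeierstrassCurve.map_Δ]
  rw [map_mul, map_mul, hr, hΔ'', ← hβ]
  ring

end Curves

/-! ### Primes in quadratic fields and the two-division field -/

/-- An algebraic closure of `ℚ`. -/
local notation "Qbar" => AlgebraicClosure ℚ

lemma isGalois_algebraicClosure (K : Type*) [Field K] [CharZero K] :
    IsGalois K (AlgebraicClosure K) :=
  inferInstance

/-- Here the `ℚ`-algebra structure is the one of every field of characteristic zero, which agrees with
the one defined for algebraic closures since there is only one. -/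
lemma isGalois_Qbar : IsGalois ℚ Qbar := by
  convert isGalois_algebraicClosure ℚ
  exact Subsingleton.elim _ _

lemma mem_sqrtField_of_sq_eq {d : ℚ} {z : Qbar} (hz : z ^ 2 = algebraMap ℚ Qbar d) :
    z ∈ sqrtField d :=
  IntermediateField.subset_adjoin _ _ hz

/-- Elements of `ℚ(√d)` in terms of a square root `α` of `m = d s²`. -/
lemma mem_sqrtField_iff {d m s : ℚ} (hd : ¬ IsSquare d) (hs : s ≠ 0) (hm : d * s ^ 2 = m)
    {α : Qbar} (hα : α ^ 2 = algebraMap ℚ Qbar m) (z : Qbar) :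
    z ∈ sqrtField d ↔ ∃ u v : ℚ, z = algebraMap ℚ Qbar u + algebraMap ℚ Qbar v * α := by
  have hs' : algebraMap ℚ Qbar s ≠ 0 := by simpa using hs
  have hm' : algebraMap ℚ Qbar d * algebraMap ℚ Qbar s ^ 2 = algebraMap ℚ Qbar m := by
    rw [← hm, map_mul, map_pow]
  have hαmem : α ∈ sqrtField d := by
    have h : α / algebraMap ℚ Qbar s ∈ sqrtField d := by
      refine mem_sqrtField_of_sq_eq ?_
      rw [div_pow, hα, ← hm']
      field_simp
    have := mul_mem h (algebraMap_mem (sqrtField d) s)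
    rwa [div_mul_cancel₀ _ hs'] at this
  constructor
  · intro hz
    induction hz using IntermediateField.adjoin_induction with
    | mem x hx =>
      have hx' : x ^ 2 = algebraMap ℚ Qbar d := hx
      have : (algebraMap ℚ Qbar s * x) ^ 2 = α ^ 2 := by rw [hα, ← hm', mul_pow, hx']; ring
      rcases sq_eq_sq_iff_eq_or_eq_neg.mp this with h | h
      · refine ⟨0, s⁻¹, ?_⟩
        rw [← h, map_inv₀, map_zero]
        field_simp
        ring
      · refine ⟨0, -s⁻¹, ?_⟩
        have h' : α = -(algebraMap ℚ Qbar s * x) := by rw [h, neg_neg]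
        rw [h', map_neg, map_inv₀, map_zero]
        field_simp
        ring
    | algebraMap x => exact ⟨x, 0, by simp⟩
    | add x y _ _ hx hy =>
      obtain ⟨u, v, rfl⟩ := hx
      obtain ⟨u', v', rfl⟩ := hy
      exact ⟨u + u', v + v', by simp only [map_add]; ring⟩
    | inv x _ hx =>
      obtain ⟨u, v, rfl⟩ := hx
      by_cases h0 : u ^ 2 - m * v ^ 2 = 0
      · have hv : v = 0 := by
          by_contra hv
          refine hd ⟨u / (v * s), ?_⟩
          rw [← hm] at h0
          field_simp
          linear_combination -h0
        have hu : u = 0 := by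
          rw [hv] at h0
          simpa using h0
        exact ⟨0, 0, by simp [hu, hv]⟩
      · refine ⟨u / (u ^ 2 - m * v ^ 2), -v / (u ^ 2 - m * v ^ 2), ?_⟩
        have hN : algebraMap ℚ Qbar (u ^ 2 - m * v ^ 2) ≠ 0 := by
          rwa [Ne, map_eq_zero]
        refine inv_eq_of_mul_eq_one_right ?_
        rw [map_div₀, map_div₀]
        field_simp
        simp only [map_neg, map_sub, map_mul, map_pow, ← hα]
        ring
    | mul x y _ _ hx hy =>
      obtain ⟨u, v, rfl⟩ := hx
      obtain ⟨u', v', rfl⟩ := hy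
      refine ⟨u * u' + m * (v * v'), u * v' + u' * v, ?_⟩
      simp only [map_add, map_mul, ← hα]
      ring
  · rintro ⟨u, v, rfl⟩
    exact add_mem (algebraMap_mem _ _) (mul_mem (algebraMap_mem _ _) hαmem)

lemma exists_int_of_isIntegral {r : ℚ} (h : IsIntegral ℤ (algebraMap ℚ Qbar r)) :
    ∃ n : ℤ, r = n := by
  rw [isIntegral_algebraMap_iff (algebraMap ℚ Qbar).injective] at h
  obtain ⟨n, hn⟩ := IsIntegrallyClosed.isIntegral_iff.mp h
  exact ⟨n, by simpa using hn.symm⟩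

/-- The arithmetic behind inertness: if `u + v √m` is integral, of trace `t` and norm `n`, and `m` is
not a square modulo `q`, then `q ∣ n` forces `q ∣ t` and `q² ∣ n`. -/
lemma dvd_of_dvd_norm {q : ℕ} [Fact q.Prime] (hq2 : q ≠ 2) {m : ℤ}
    (hnsq : ¬ IsSquare (m : ZMod q)) {v : ℚ} {t n : ℤ}
    (hn : (t : ℚ) ^ 2 - m * (2 * v) ^ 2 = 4 * n) (hqn : (q : ℤ) ∣ n) :
    (q : ℤ) ∣ t ∧ (q : ℤ) ^ 2 ∣ n := by
  have hqp : Prime (q : ℤ) := Nat.prime_iff_prime_int.mp Fact.out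
  have hqm : ¬ (q : ℤ) ∣ m := by
    intro h
    rw [← ZMod.intCast_zmod_eq_zero_iff_dvd] at h
    exact hnsq (by rw [h]; exact IsSquare.zero)
  set w := 2 * v with hw
  have he0 : (w.den : ℚ) ≠ 0 := by exact_mod_cast w.den_nz
  have hwcd : w = w.num / w.den := (Rat.num_div_den w).symm
  generalize hc : w.num = c at hwcd
  generalize he : w.den = e at hwcd he0
  have hcop : IsCoprime c (e : ℤ) := by
    rw [← hc, ← he]
    exact Int.isCoprime_iff_gcd_eq_one.mpr w.reduced
  have hZ : m * c ^ 2 = (t ^ 2 - 4 * n) * (e : ℤ) ^ 2 := by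
    have : (m : ℚ) * c ^ 2 = (t ^ 2 - 4 * n) * (e : ℚ) ^ 2 := by
      rw [hwcd] at hn
      field_simp at hn
      linear_combination -hn
    exact_mod_cast this
  have hqe : ¬ (q : ℤ) ∣ e := by
    intro h
    have h1 : (q : ℤ) ∣ m * c ^ 2 := by
      rw [hZ]
      exact (dvd_pow h two_ne_zero).mul_left _
    have h2 := hqp.dvd_of_dvd_pow ((hqp.dvd_or_dvd h1).resolve_left hqm)
    exact hqp.not_isUnit (hcop.isUnit_of_dvd' h2 h)
  have he' : (e : ZMod q) ≠ 0 := by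
    intro h
    refine hqe ((ZMod.intCast_zmod_eq_zero_iff_dvd _ _).mp ?_)
    exact_mod_cast h
  have hmod : (m : ZMod q) * c ^ 2 = t ^ 2 * (e : ZMod q) ^ 2 := by
    have h0 : (n : ZMod q) = 0 := (ZMod.intCast_zmod_eq_zero_iff_dvd _ _).mpr hqn
    have := congrArg (Int.cast : ℤ → ZMod q) hZ
    push_cast at this
    rw [this, h0]
    ring
  have hc0 : (c : ZMod q) = 0 := by
    by_contra hc0
    refine hnsq ⟨t * e / c, ?_⟩
    field_simp
    linear_combination hmod
  have ht : (q : ℤ) ∣ t := by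
    rw [← ZMod.intCast_zmod_eq_zero_iff_dvd]
    rw [hc0] at hmod
    have : ((t : ZMod q) * e) ^ 2 = 0 := by linear_combination -hmod
    exact (mul_eq_zero.mp (pow_eq_zero_iff two_ne_zero |>.mp this)).resolve_right he'
  refine ⟨ht, ?_⟩
  have hcq := (ZMod.intCast_zmod_eq_zero_iff_dvd _ _).mp hc0
  have h1 : (q : ℤ) ^ 2 ∣ n * (4 * (e : ℤ) ^ 2) := by
    have : n * (4 * (e : ℤ) ^ 2) = t ^ 2 * (e : ℤ) ^ 2 - m * c ^ 2 := by rw [hZ]; ring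
    rw [this]
    exact dvd_sub ((pow_dvd_pow_of_dvd ht 2).mul_right _) ((pow_dvd_pow_of_dvd hcq 2).mul_left _)
  have hq2' : ¬ (q : ℤ) ∣ 2 := by
    intro h
    have := (Nat.prime_dvd_prime_iff_eq Fact.out Nat.prime_two).mp (by exact_mod_cast h)
    exact hq2 this
  refine (IsCoprime.pow_left ?_).dvd_of_dvd_mul_right h1
  rw [hqp.irreducible.coprime_iff_not_dvd]
  intro h
  rcases hqp.dvd_or_dvd h with h | h
  · exact hq2' (hqp.dvd_of_dvd_pow (show (q : ℤ) ∣ 2 ^ 2 by norm_num; exact h))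
  · exact hqe (hqp.dvd_of_dvd_pow h)

/-- Dedekind's criterion for a quadratic field: an odd prime `q` not dividing `m` is inert in
`ℚ(√m)` if and only if `m` is not a square modulo `q`. The field is given as `ℚ(√d)`, where
`m = d s²`. -/
theorem isInertIn_sqrtField_iff {q : ℕ} [Fact q.Prime] (hq2 : q ≠ 2) {d s : ℚ} {m : ℤ}
    (hd : ¬ IsSquare d) (hs : s ≠ 0) (hm : d * s ^ 2 = m) (hqm : ¬ (q : ℤ) ∣ m) :
    IsInertIn q (sqrtField d) ↔ ¬ IsSquare (m : ZMod q) := by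
  have hqp : Prime (q : ℤ) := Nat.prime_iff_prime_int.mp Fact.out
  have hq0 : (q : Qbar) ≠ 0 := by exact_mod_cast (Fact.out : q.Prime).ne_zero
  obtain ⟨α, hα⟩ := IsAlgClosed.exists_pow_nat_eq (algebraMap ℚ Qbar m) (n := 2) (by norm_num)
  have hmem := mem_sqrtField_iff hd hs hm hα
  have hαZ : IsIntegral ℤ α := by
    refine IsIntegral.of_pow (n := 2) (by norm_num) ?_
    rw [hα, map_intCast]
    exact isIntegral_algebraMap (x := m)
  -- the nontrivial automorphism of `ℚ(√m)`
  obtain ⟨σ, hσ⟩ : ∃ σ : Qbar ≃ₐ[ℚ] Qbar, σ α = -α := by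
    have := isGalois_Qbar
    have hnot : ¬ ∀ σ : Qbar ≃ₐ[ℚ] Qbar, σ α = α := by
      intro h
      obtain ⟨r, hr⟩ := (InfiniteGalois.mem_range_algebraMap_iff_fixed α).mpr h
      rw [← hr, ← map_pow] at hα
      have := (algebraMap ℚ Qbar).injective hα
      refine hd ⟨r / s, ?_⟩
      rw [← hm] at this
      field_simp
      linear_combination -this
    push Not at hnot
    obtain ⟨σ, hσ⟩ := hnot
    refine ⟨σ, (sq_eq_sq_iff_eq_or_eq_neg.mp ?_).resolve_left hσ⟩
    rw [← map_pow, hα, AlgEquiv.commutes]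
  set ι : NumberField.RingOfIntegers (sqrtField d) →+* Qbar :=
    (algebraMap (sqrtField d) Qbar).comp (algebraMap _ (sqrtField d)) with hι
  have hιinj : Function.Injective ι :=
    (algebraMap (sqrtField d) Qbar).injective.comp NumberField.RingOfIntegers.coe_injective
  have hιmem : ∀ x, ι x ∈ sqrtField d := fun x ↦ (algebraMap _ (sqrtField d) x).2
  have hιint : ∀ x, IsIntegral ℤ (ι x) := fun x ↦
    (NumberField.RingOfIntegers.isIntegral_coe x).map
      (IsScalarTower.toAlgHom ℤ (sqrtField d) Qbar)
  have hιsurj : ∀ z ∈ sqrtField d, IsIntegral ℤ z → ∃ x, ι x = z := by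
    intro z hz hzi
    have : IsIntegral ℤ (⟨z, hz⟩ : sqrtField d) :=
      (isIntegral_algebraMap_iff (algebraMap (sqrtField d) Qbar).injective).mp hzi
    exact ⟨⟨_, this⟩, rfl⟩
  have hιq : ι (q : NumberField.RingOfIntegers (sqrtField d)) = q := map_natCast ι q
  have hσi : ∀ {z : Qbar}, IsIntegral ℤ z → IsIntegral ℤ (σ z) := fun hz ↦
    hz.map (σ.toAlgHom.restrictScalars ℤ)
  have hq0' : (q : NumberField.RingOfIntegers (sqrtField d)) ≠ 0 := by
    intro h
    rw [h, map_zero] at hιq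
    exact hq0 hιq.symm
  rw [IsInertIn, Ideal.span_singleton_prime hq0']
  -- norms and traces of integral elements are integers
  have hnt : ∀ x, ∃ (u v : ℚ) (t n : ℤ), ι x = algebraMap ℚ Qbar u + algebraMap ℚ Qbar v * α ∧
      2 * u = t ∧ u ^ 2 - m * v ^ 2 = n ∧ ι x + σ (ι x) = t ∧ ι x * σ (ι x) = n := by
    intro x
    obtain ⟨u, v, huv⟩ := (hmem _).mp (hιmem x)
    have hσx : σ (ι x) = algebraMap ℚ Qbar u - algebraMap ℚ Qbar v * α := by
      rw [huv, map_add, map_mul, hσ, AlgEquiv.commutes, AlgEquiv.commutes]; ring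
    have htr : ι x + σ (ι x) = algebraMap ℚ Qbar (2 * u) := by
      rw [hσx, huv, map_mul, map_ofNat]; ring
    have hno : ι x * σ (ι x) = algebraMap ℚ Qbar (u ^ 2 - m * v ^ 2) := by
      rw [hσx, huv]
      simp only [map_sub, map_mul, map_pow, ← hα]
      ring
    obtain ⟨t, ht⟩ := exists_int_of_isIntegral (r := 2 * u)
      (by rw [← htr]; exact (hιint x).add (hσi (hιint x)))
    obtain ⟨n, hn⟩ := exists_int_of_isIntegral (r := u ^ 2 - m * v ^ 2)
      (by rw [← hno]; exact (hιint x).mul (hσi (hιint x)))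
    exact ⟨u, v, t, n, huv, ht, hn, by rw [htr, ht, map_intCast], by rw [hno, hn, map_intCast]⟩
  constructor
  · -- a congruence `m ≡ k²` factors `q ∣ m - k²` as `(√m - k) (√m + k)`
    rintro hprime ⟨k, hk⟩
    obtain ⟨k, rfl⟩ := ZMod.intCast_surjective k
    have hdvd : (q : ℤ) ∣ m - k * k := by
      rw [← ZMod.intCast_zmod_eq_zero_iff_dvd]
      push_cast
      rw [hk, sub_self]
    obtain ⟨l, hl⟩ := hdvd
    obtain ⟨a, ha⟩ := hιsurj α ((hmem α).mpr ⟨0, 1, by simp⟩) hαZ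
    -- neither factor is divisible by `q`, as one sees on traces
    have hno : ∀ j : ℤ, (q : ℤ) ∣ m - j * j →
        ¬ (q : NumberField.RingOfIntegers (sqrtField d)) ∣ a + j := by
      rintro j hj ⟨b, hb⟩
      obtain ⟨-, -, t, -, -, -, -, htr, -⟩ := hnt b
      have e1 : α + j = q * ι b := by
        rw [← ha, ← hιq, ← map_mul, ← hb, map_add, map_intCast]
      have e2 : -α + j = q * σ (ι b) := by
        have := congrArg σ e1
        rwa [map_add, map_mul, map_intCast, map_natCast, hσ] at this
      have e3 : (2 * j : Qbar) = q * t := by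
        rw [← htr]
        linear_combination e1 + e2
      have e4 : 2 * j = q * t := by exact_mod_cast e3
      rcases hqp.dvd_or_dvd (Dvd.intro _ e4.symm) with h | h
      · have := (Nat.prime_dvd_prime_iff_eq Fact.out Nat.prime_two).mp (by exact_mod_cast h)
        exact hq2 this
      · have := dvd_add hj (h.mul_right j)
        rw [sub_add_cancel] at this
        exact hqm this
    have hfac : (q : NumberField.RingOfIntegers (sqrtField d)) ∣
        (a + (k : ℤ)) * (a + ((-k : ℤ) : NumberField.RingOfIntegers (sqrtField d))) := by
      refine ⟨(l : ℤ), hιinj ?_⟩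
      have hl' : (m : Qbar) - k * k = q * l := by exact_mod_cast hl
      rw [map_intCast] at hα
      simp only [map_mul, map_add, map_intCast, ha, hιq]
      push_cast
      linear_combination hα + hl'
    rcases hprime.dvd_or_dvd hfac with h | h
    · exact hno k ⟨l, hl⟩ h
    · exact hno (-k) ⟨l, by rw [← hl]; ring⟩ h
  · intro hnsq
    -- an integral element whose norm is divisible by `q` is divisible by `q`
    have hdiv : ∀ x (n : ℤ), ι x * σ (ι x) = n → (q : ℤ) ∣ n →
        (q : NumberField.RingOfIntegers (sqrtField d)) ∣ x := by
      intro x n hxn hqn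
      obtain ⟨u, v, t, n', huv, hu, hn, htr, hno⟩ := hnt x
      obtain rfl : n' = n := by
        have := hno.symm.trans hxn
        exact_mod_cast this
      obtain ⟨⟨t', ht'⟩, ⟨n'', hn''⟩⟩ := dvd_of_dvd_norm hq2 hnsq (v := v) (t := t) (n := n')
        (by rw [← hu, ← hn]; ring) hqn
      have hint : IsIntegral ℤ (ι x / q) := by
        refine ⟨Polynomial.X ^ 2 + (Polynomial.C (-t') * Polynomial.X + Polynomial.C n''),
          ?_, ?_⟩
        · refine Polynomial.monic_X_pow_add ?_
          refine lt_of_le_of_lt Polynomial.degree_linear_le ?_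
          norm_num
        · have ht2 : (t : Qbar) = q * t' := by exact_mod_cast ht'
          have hn2 : (n' : Qbar) = q ^ 2 * n'' := by exact_mod_cast hn''
          rw [ht2] at htr
          rw [hn2] at hno
          simp only [Polynomial.eval₂_add, Polynomial.eval₂_mul, Polynomial.eval₂_pow,
            Polynomial.eval₂_X, Polynomial.eval₂_C]
          simp only [eq_intCast]
          field_simp
          push_cast
          linear_combination (ι x) * htr - hno
      obtain ⟨y, hy⟩ := hιsurj _ (div_mem (hιmem x) (natCast_mem _ q)) hint
      refine ⟨y, hιinj ?_⟩
      rw [map_mul, hιq, hy]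
      field_simp
    refine ⟨hq0', ?_, ?_⟩
    · intro hunit
      obtain ⟨y, hy⟩ := isUnit_iff_exists_inv.mp hunit
      obtain ⟨-, -, -, n, -, -, -, -, hno⟩ := hnt y
      have e1 : (q : Qbar) * ι y = 1 := by rw [← hιq, ← map_mul, hy, map_one]
      have e2 : (q : Qbar) * σ (ι y) = 1 := by
        have := congrArg σ e1
        rwa [map_mul, map_natCast, map_one] at this
      have e3 : (q : Qbar) * (q * n) = 1 := by
        rw [← hno]
        linear_combination (q * σ (ι y)) * e1 + e2
      have e4 : (q : ℤ) * (q * n) = 1 := by exact_mod_cast e3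
      exact hqp.not_isUnit (IsUnit.of_mul_eq_one _ e4)
    · rintro x y ⟨w, hw⟩
      obtain ⟨-, -, -, nx, -, -, -, -, hx⟩ := hnt x
      obtain ⟨-, -, -, ny, -, -, -, -, hy⟩ := hnt y
      obtain ⟨-, -, -, nw, -, -, -, -, hw'⟩ := hnt w
      have e1 : ι x * ι y = q * ι w := by rw [← map_mul, hw, map_mul, hιq]
      have e2 : σ (ι x) * σ (ι y) = q * σ (ι w) := by
        have := congrArg σ e1
        rwa [map_mul, map_mul, map_natCast] at this
      have e3 : (nx * ny : Qbar) = q * (q * nw) := by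
        rw [← hx, ← hy, ← hw']
        linear_combination (σ (ι x) * σ (ι y)) * e1 + q * ι w * e2
      have e4 : nx * ny = q * (q * nw) := by exact_mod_cast e3
      rcases hqp.dvd_or_dvd (Dvd.intro _ e4.symm) with h | h
      · exact Or.inl (hdiv x nx hx h)
      · exact Or.inr (hdiv y ny hy h)

lemma SplitsIn.not_isInertIn {q : ℕ} (hq : q ≠ 0) {L : Type*} [Field L] [CharZero L]
    (hs : SplitsIn q L) : ¬ IsInertIn q L := by
  obtain ⟨P, Q, hP, hQ, -, hPQ⟩ := hs
  intro hin
  have hq0 : (q : NumberField.RingOfIntegers L) ≠ 0 := by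
    exact_mod_cast hq
  -- `(q) = (q) I` is impossible for a proper ideal `I`
  have key : ∀ I J : Ideal (NumberField.RingOfIntegers L), I.IsPrime →
      J * I = Ideal.span {(q : NumberField.RingOfIntegers L)} →
      ¬ J ≤ Ideal.span {(q : NumberField.RingOfIntegers L)} := by
    intro I J hI hJI hJ
    have hJ' : J = Ideal.span {(q : NumberField.RingOfIntegers L)} :=
      le_antisymm hJ (hJI.symm.le.trans Ideal.mul_le_left)
    rw [hJ'] at hJI
    have hmem : (q : NumberField.RingOfIntegers L) ∈
        Ideal.span {(q : NumberField.RingOfIntegers L)} * I := by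
      rw [hJI]
      exact Ideal.mem_span_singleton_self _
    rw [Ideal.mem_span_singleton_mul] at hmem
    obtain ⟨z, hz, hzq⟩ := hmem
    have : z = 1 := mul_left_cancel₀ hq0 (by rw [hzq, mul_one])
    exact hI.ne_top ((Ideal.eq_top_iff_one _).mpr (this ▸ hz))
  rcases (Ideal.IsPrime.mul_le hin).mp hPQ.ge with h | h
  · exact key Q P hQ hPQ.symm h
  · exact key P Q hP (by rw [mul_comm, hPQ]) h

open scoped Classical in
lemma some_mem_twoTorsion_iff {E : WeierstrassCurve ℚ} {F : Type*} [Field F] [Algebra ℚ F]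
    {x y : F} (h : (E.toAffine⁄F).Nonsingular x y) :
    WeierstrassCurve.Affine.Point.some x y h ∈ twoTorsion E F ↔
      IsTwoTorsionPt (E.baseChange F) x y := by
  have h1 : WeierstrassCurve.Affine.Point.some x y h ∈ twoTorsion E F ↔
      (2 : ℤ) • WeierstrassCurve.Affine.Point.some x y h = 0 := by
    simp [twoTorsion]
  rw [h1, two_smul]
  exact (IsTwoTorsionPt.iff_add_self_eq_zero h).symm

/-- Given a rational point of order two, the other two generate `ℚ(√Δ)`, because the quadratic
factor of the `2`-division polynomial has discriminant `Δ` up to squares. -/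
theorem twoDivisionField_eq_sqrtField {E : WeierstrassCurve ℚ} [E.IsElliptic] {x₀ y₀ : ℚ}
    (hT : IsTwoTorsionPt E x₀ y₀) : twoDivisionField E = sqrtField E.Δ := by
  have hΔ := baseChange_Δ_ne_zero E Qbar
  have hTF : IsTwoTorsionPt (E.baseChange Qbar) (algebraMap ℚ Qbar x₀) (algebraMap ℚ Qbar y₀) :=
    hT.map (algebraMap ℚ Qbar)
  have hb := linCoeff_map E x₀ y₀ (algebraMap ℚ Qbar)
  change linCoeff (E.baseChange Qbar) _ _ = _ at hb
  have hb0 := hTF.linCoeff_ne_zero hΔ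
  have ha : quadCoeff (E.baseChange Qbar) (algebraMap ℚ Qbar x₀) =
      algebraMap ℚ Qbar (quadCoeff E x₀) := by
    simp [quadCoeff, WeierstrassCurve.baseChange]
  have hΔ' : algebraMap ℚ Qbar E.Δ = (E.baseChange Qbar).Δ := by
    rw [WeierstrassCurve.baseChange, WeierstrassCurve.map_Δ]
  have hΔeq := hTF.Δ_eq
  apply le_antisymm
  · refine IntermediateField.adjoin_le_iff.mpr ?_
    rintro z ⟨x, y, h, hmem, hz⟩
    have hP := (some_mem_twoTorsion_iff h).mp hmem
    have hx : x ∈ sqrtField E.Δ := by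
      by_cases hx : x = algebraMap ℚ Qbar x₀
      · rw [hx]; exact algebraMap_mem _ _
      · have hsq := hTF.sq_eq_of_ne hP hx
        set w := algebraMap ℚ Qbar (linCoeff E x₀ y₀) *
          (8 * (x - algebraMap ℚ Qbar x₀) + algebraMap ℚ Qbar (quadCoeff E x₀)) with hw
        have hwmem : w ∈ sqrtField E.Δ := by
          refine mem_sqrtField_of_sq_eq ?_
          rw [hΔ', hΔeq, ← hsq, hb, ha, hw]
          ring
        rw [hb] at hb0
        have hxw : x = algebraMap ℚ Qbar x₀ + (w / algebraMap ℚ Qbar (linCoeff E x₀ y₀) -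
            algebraMap ℚ Qbar (quadCoeff E x₀)) / algebraMap ℚ Qbar 8 := by
          rw [hw, map_ofNat]
          field_simp
          ring
        rw [hxw]
        exact add_mem (algebraMap_mem _ _) (div_mem (sub_mem (div_mem hwmem (algebraMap_mem _ _))
          (algebraMap_mem _ _)) (algebraMap_mem _ _))
    rcases hz with rfl | rfl
    · exact hx
    · have h3 := hP.neg_eq
      have hy : z = -(algebraMap ℚ Qbar E.a₁ * x + algebraMap ℚ Qbar E.a₃) /
          algebraMap ℚ Qbar 2 := by
        simp only [WeierstrassCurve.baseChange, WeierstrassCurve.map_a₁,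
          WeierstrassCurve.map_a₃] at h3
        rw [map_ofNat]
        field_simp
        linear_combination h3
      rw [hy]
      exact div_mem (neg_mem (add_mem (mul_mem (algebraMap_mem _ _) hx) (algebraMap_mem _ _)))
        (algebraMap_mem _ _)
  · refine IntermediateField.adjoin_le_iff.mpr ?_
    intro z hz
    have hz' : z ^ 2 = algebraMap ℚ Qbar E.Δ := hz
    rw [hb] at hb0
    set x := algebraMap ℚ Qbar x₀ + (z / algebraMap ℚ Qbar (linCoeff E x₀ y₀) -
            algebraMap ℚ Qbar (quadCoeff E x₀)) / 8 with hx
    have hP := hTF.of_sq_eq two_ne_zero (x := x) (by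
      have : 8 * (x - algebraMap ℚ Qbar x₀) + quadCoeff (E.baseChange Qbar) (algebraMap ℚ Qbar x₀)
          = z / algebraMap ℚ Qbar (linCoeff E x₀ y₀) := by
        rw [hx, ha]; field_simp; ring
      rw [this, div_pow, hz', hΔ', hΔeq, hb]
      field_simp)
    have hxmem : x ∈ twoDivisionField E :=
      IntermediateField.subset_adjoin _ _ ⟨x, _, hP.nonsingular hΔ,
        (some_mem_twoTorsion_iff _).mpr hP, Or.inl rfl⟩
    have hzx : z = algebraMap ℚ Qbar (linCoeff E x₀ y₀) * (algebraMap ℚ Qbar 8 *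
        (x - algebraMap ℚ Qbar x₀) + algebraMap ℚ Qbar (quadCoeff E x₀)) := by
      rw [hx, map_ofNat]
      field_simp
      ring
    rw [hzx]
    exact mul_mem (algebraMap_mem _ _) (add_mem (mul_mem (algebraMap_mem _ _)
      (sub_mem hxmem (algebraMap_mem _ _))) (algebraMap_mem _ _))

open scoped Classical in
lemma not_isSquare_Δ {E : WeierstrassCurve ℚ} [E.IsElliptic] {x₀ y₀ : ℚ}
    {hns : (E.toAffine⁄ℚ).Nonsingular x₀ y₀} (hT : IsTwoTorsionPt E x₀ y₀)
    (huniq : ∀ P : (E.toAffine⁄ℚ).Point, P ∈ twoTorsion E ℚ ↔ P = 0 ∨ P = .some x₀ y₀ hns) :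
    ¬ IsSquare E.Δ := by
  rintro ⟨r, hr⟩
  have hΔ := E.isUnit_Δ.ne_zero
  have hb := hT.linCoeff_ne_zero hΔ
  set x := x₀ + (r / linCoeff E x₀ y₀ - quadCoeff E x₀) / 8 with hx
  have h8 : 8 * (x - x₀) + quadCoeff E x₀ = r / linCoeff E x₀ y₀ := by
    rw [hx]; ring
  have hsq : (8 * (x - x₀) + quadCoeff E x₀) ^ 2 =
      quadCoeff E x₀ ^ 2 - 64 * linCoeff E x₀ y₀ := by
    rw [h8, div_pow, pow_two r, ← hr, hT.Δ_eq]
    field_simp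
  have hP := hT.of_sq_eq two_ne_zero hsq
  have hE : E.baseChange ℚ = E := WeierstrassCurve.map_id E
  have hns' : (E.toAffine⁄ℚ).Nonsingular x (-(E.a₁ * x + E.a₃) / 2) := by
    have := hP.nonsingular hΔ
    rwa [← hE] at this
  have hmem := (some_mem_twoTorsion_iff hns').mpr (by rwa [hE])
  rcases (huniq _).mp hmem with e | e
  · exact WeierstrassCurve.Affine.Point.some_ne_zero _ e
  · rw [WeierstrassCurve.Affine.Point.some.injEq] at e
    rw [e.1] at hsq
    have : 64 * linCoeff E x₀ y₀ = 0 := by linear_combination hsq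
    exact hb (by linarith)

/-! ### Good reduction and squares in the field of `q`-adic numbers -/

section Padic

variable {q : ℕ} [Fact q.Prime]

lemma isUnit_two_padicInt (hq2 : q ≠ 2) : IsUnit (2 : ℤ_[q]) := by
  have h : ‖((2 : ℕ) : ℤ_[q])‖ = 1 := by
    rw [PadicInt.norm_natCast_eq_one_iff, Nat.coprime_primes Fact.out Nat.prime_two]
    exact hq2
  rw [PadicInt.isUnit_iff]
  exact_mod_cast h

/-- Hensel's lemma for square roots of units, with `q` odd. -/
lemma isSquare_coe_iff (hq2 : q ≠ 2) {w : ℤ_[q]} (hw : IsUnit w) :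
    IsSquare (w : ℚ_[q]) ↔ IsSquare (PadicInt.toZMod w) := by
  constructor
  · rintro ⟨r, hr⟩
    have hn : ‖r‖ * ‖r‖ = 1 := by
      rw [← norm_mul, ← hr, ← PadicInt.norm_def, PadicInt.isUnit_iff.mp hw]
    have hr1 : ‖r‖ ≤ 1 := by nlinarith [norm_nonneg r]
    obtain ⟨r, rfl⟩ : ∃ r' : ℤ_[q], (r' : ℚ_[q]) = r := ⟨⟨r, hr1⟩, rfl⟩
    have : w = r * r := PadicInt.ext (by rw [hr, PadicInt.coe_mul])
    rw [this, map_mul]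
    exact ⟨_, rfl⟩
  · rintro ⟨k, hk⟩
    obtain ⟨K, rfl⟩ := ZMod.ringHom_surjective (PadicInt.toZMod (p := q)) k
    have hker : K ^ 2 - w ∈ IsLocalRing.maximalIdeal ℤ_[q] := by
      rw [← PadicInt.ker_toZMod, RingHom.mem_ker, map_sub, map_pow, hk]
      ring
    have hlt : ‖K ^ 2 - w‖ < 1 := by
      rw [← PadicInt.mem_nonunits]
      exact (IsLocalRing.mem_maximalIdeal _).mp hker
    have hK : IsUnit K := by
      by_contra hK
      refine (IsLocalRing.mem_maximalIdeal w).mp ?_ hw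
      have h2 := Ideal.pow_mem_of_mem _ ((IsLocalRing.mem_maximalIdeal K).mpr hK) 2 two_pos
      have := sub_mem h2 hker
      rwa [sub_sub_cancel] at this
    have h2K : ‖2 * K‖ = 1 := PadicInt.isUnit_iff.mp ((isUnit_two_padicInt hq2).mul hK)
    obtain ⟨z, hz, -⟩ := hensels_lemma (p := q) (R := ℤ_[q])
      (F := Polynomial.X ^ 2 - Polynomial.C w) (a := K) (by
        simp only [map_sub, map_pow, Polynomial.aeval_X, Polynomial.aeval_C,
          Polynomial.derivative_X_pow, Polynomial.derivative_C]
        simpa [h2K] using hlt)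
    refine ⟨z, ?_⟩
    have : z ^ 2 = w := by
      simpa [sub_eq_zero] using hz
    rw [← this]
    push_cast
    ring

/-- A rational number which is a unit times a square at `q` is a square times an integer prime
to `q`. -/
lemma exists_int_mul_sq {d : ℚ} {w : ℤ_[q]} (hw : IsUnit w) {c : ℚ_[q]} (hc : c ≠ 0)
    (h : (d : ℚ_[q]) = w * c ^ 2) :
    ∃ (s : ℚ) (m : ℤ), s ≠ 0 ∧ d * s ^ 2 = m ∧ ¬ (q : ℤ) ∣ m := by
  have hqQ : (q : ℚ) ≠ 0 := by exact_mod_cast (Fact.out : q.Prime).ne_zero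
  have hqR : (q : ℝ) ≠ 0 := by exact_mod_cast (Fact.out : q.Prime).ne_zero
  set k := -c.valuation with hk
  set d' : ℚ := d * ((q : ℚ) ^ k) ^ 2 with hd'
  have hnorm : ‖(d' : ℚ_[q])‖ = 1 := by
    rw [hd']
    push_cast
    rw [h, norm_mul, norm_mul, norm_pow, norm_pow, Padic.norm_p_zpow,
      Padic.norm_eq_zpow_neg_valuation hc, ← hk, ← PadicInt.norm_def, PadicInt.isUnit_iff.mp hw,
      one_mul, ← mul_pow, ← zpow_add₀ hqR, add_neg_cancel, zpow_zero, one_pow]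
  have hden := PadicInt.isUnit_iff.mp (PadicInt.isUnit_den d' hnorm.le)
  have hdenQ : (d'.den : ℚ) ≠ 0 := by exact_mod_cast d'.den_nz
  have hmul : d' * (d'.den : ℚ) ^ 2 = (d'.num * d'.den : ℤ) := by
    push_cast
    have := Rat.mul_den_eq_num d'
    linear_combination (d'.den : ℚ) * this
  refine ⟨(q : ℚ) ^ k * d'.den, d'.num * d'.den, mul_ne_zero (zpow_ne_zero _ hqQ) hdenQ, ?_, ?_⟩
  · rw [← hmul, hd']
    ring
  · rw [← PadicInt.norm_int_lt_one_iff_dvd, not_lt]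
    have h1 : (((d'.num * d'.den : ℤ) : ℤ_[q]) : ℚ_[q]) = d' * (d'.den : ℚ_[q]) ^ 2 := by
      have := congrArg (Rat.cast : ℚ → ℚ_[q]) hmul
      push_cast at this ⊢
      exact this.symm
    have h3 : ‖(d'.den : ℚ_[q])‖ = 1 := by
      rw [← hden, PadicInt.norm_def, PadicInt.coe_natCast]
    rw [PadicInt.norm_def, h1, norm_mul, norm_pow, hnorm, h3]
    norm_num

/-- `q` is inert in `ℚ(√d)` according to the residue of the unit part of `d` at `q`. -/
theorem isInertIn_sqrtField_iff_toZMod (hq2 : q ≠ 2) {d : ℚ} (hd : ¬ IsSquare d) {w : ℤ_[q]}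
    (hw : IsUnit w) {c : ℚ_[q]} (hc : c ≠ 0) (h : (d : ℚ_[q]) = w * c ^ 2) :
    IsInertIn q (sqrtField d) ↔ ¬ IsSquare (PadicInt.toZMod w) := by
  obtain ⟨s, m, hs, hm, hqm⟩ := exists_int_mul_sq hw hc h
  rw [isInertIn_sqrtField_iff hq2 hd hs hm hqm, not_iff_not, ← isSquare_coe_iff hq2 hw,
    ← map_intCast (PadicInt.toZMod (p := q)) m, ← isSquare_coe_iff hq2]
  · have hs' : (s : ℚ_[q]) ≠ 0 := by exact_mod_cast hs
    have hmw : ((m : ℤ_[q]) : ℚ_[q]) = w * (c * s) ^ 2 := by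
      have := congrArg (Rat.cast : ℚ → ℚ_[q]) hm
      push_cast at this ⊢
      rw [← this, h]
      ring
    rw [hmw]
    constructor
    · rintro ⟨r, hr⟩
      refine ⟨r / (c * s), ?_⟩
      field_simp
      linear_combination hr
    · intro hsq
      exact hsq.mul (IsSquare.sq _)
  · rw [PadicInt.isUnit_iff]
    refine le_antisymm (PadicInt.norm_le_one _) (not_lt.mp ?_)
    rwa [PadicInt.norm_int_lt_one_iff_dvd]

/-- A point of order two on the generic fibre of an integral model is integral, because `2` is
invertible and `4 x` is a root of a monic polynomial. -/
lemma IsTwoTorsionPt.exists_integral (hq2 : q ≠ 2) {I : WeierstrassCurve ℤ_[q]} {x y : ℚ_[q]}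
    (h : IsTwoTorsionPt (I.baseChange ℚ_[q]) x y) :
    ∃ X Y : ℤ_[q], IsTwoTorsionPt I X Y ∧ (X : ℚ_[q]) = x ∧ (Y : ℚ_[q]) = y := by
  obtain ⟨e, he⟩ := isUnit_iff_exists_inv.mp (isUnit_two_padicInt hq2)
  have he' : (2 : ℚ_[q]) * algebraMap ℤ_[q] ℚ_[q] e = 1 := by
    rw [← map_ofNat (algebraMap ℤ_[q] ℚ_[q]) 2, ← map_mul, he, map_one]
  have hcub := h.cubic_eq
  have hint : IsIntegral ℤ_[q] (4 * x) := by
    refine ⟨Polynomial.X ^ 3 + (Polynomial.C I.b₂ * Polynomial.X ^ 2 +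
      Polynomial.C (8 * I.b₄) * Polynomial.X + Polynomial.C (16 * I.b₆)), ?_, ?_⟩
    · refine Polynomial.monic_X_pow_add ?_
      refine lt_of_le_of_lt Polynomial.degree_quadratic_le ?_
      norm_num
    · simp only [WeierstrassCurve.baseChange, WeierstrassCurve.map_b₂, WeierstrassCurve.map_b₄,
        WeierstrassCurve.map_b₆] at hcub
      simp only [Polynomial.eval₂_add, Polynomial.eval₂_mul, Polynomial.eval₂_pow,
        Polynomial.eval₂_X, Polynomial.eval₂_C, map_mul, map_ofNat, Polynomial.eval₂_ofNat]
      linear_combination 16 * hcub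
  obtain ⟨Z, hZ⟩ := IsIntegrallyClosed.isIntegral_iff.mp hint
  have hX : algebraMap ℤ_[q] ℚ_[q] (Z * e ^ 2) = x := by
    rw [map_mul, map_pow, hZ]
    linear_combination x * (2 * algebraMap ℤ_[q] ℚ_[q] e + 1) * he'
  have hY : algebraMap ℤ_[q] ℚ_[q] (-(I.a₁ * (Z * e ^ 2) + I.a₃) * e) = y := by
    have h3 := h.neg_eq
    simp only [WeierstrassCurve.baseChange, WeierstrassCurve.map_a₁, WeierstrassCurve.map_a₃] at h3
    rw [map_mul, map_neg, map_add, map_mul, hX]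
    linear_combination y * he' - algebraMap ℤ_[q] ℚ_[q] e * h3
  refine ⟨_, _, ?_, hX, hY⟩
  have hinj := FaithfulSMul.algebraMap_injective ℤ_[q] ℚ_[q]
  rw [← hX, ← hY] at h
  have h1 := h.equation
  have h2 := h.neg_eq
  simp only [WeierstrassCurve.baseChange, WeierstrassCurve.map_a₁, WeierstrassCurve.map_a₂,
    WeierstrassCurve.map_a₃, WeierstrassCurve.map_a₄, WeierstrassCurve.map_a₆] at h1 h2
  rw [← map_ofNat (algebraMap ℤ_[q] ℚ_[q]) 2] at h2
  simp only [← map_mul, ← map_add, ← map_pow] at h1 h2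
  exact ⟨hinj h1, hinj (h2.trans (map_zero _).symm)⟩

/-- At an odd prime of good reduction, `Δ` and `b` are squares times units, and the residues of these
units decide whether `4` divides the number of points of the reduction. -/
theorem exists_units_of_goodReduction (hq2 : q ≠ 2) {E : WeierstrassCurve ℚ}
    (hgood : GoodReductionAt E q) {x₀ y₀ : ℚ} (hT : IsTwoTorsionPt E x₀ y₀) :
    ∃ (δ β : ℤ_[q]) (c c' : ℚ_[q]), IsUnit δ ∧ IsUnit β ∧ c ≠ 0 ∧ c' ≠ 0 ∧
      (E.Δ : ℚ_[q]) = δ * c ^ 2 ∧ ((linCoeff E x₀ y₀ : ℚ) : ℚ_[q]) = β * c' ^ 2 ∧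
      2 ∣ Nat.card ((minimalAt E q).reduction ℤ_[q]).toAffine.Point ∧
      (4 ∣ Nat.card ((minimalAt E q).reduction ℤ_[q]).toAffine.Point ↔
        IsSquare (PadicInt.toZMod δ) ∨ IsSquare (PadicInt.toZMod β)) := by
  obtain ⟨C, hC⟩ : ∃ C : WeierstrassCurve.VariableChange ℚ_[q],
    minimalAt E q = C • E.baseChange ℚ_[q] := ⟨_, rfl⟩
  set I := (minimalAt E q).integralModel ℤ_[q] with hI
  have hIW : I.baseChange ℚ_[q] = C • E.baseChange ℚ_[q] := by
    rw [← hC]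
    exact WeierstrassCurve.baseChange_integralModel_eq ℤ_[q] _
  have hred : (minimalAt E q).reduction ℤ_[q] = I.map (IsLocalRing.residue ℤ_[q]) := rfl
  have hell : ((minimalAt E q).reduction ℤ_[q]).IsElliptic :=
    WeierstrassCurve.hasGoodReduction_iff_isElliptic_reduction ℤ_[q] |>.mp hgood
  have hΔred := hell.isUnit.ne_zero
  rw [hred] at hΔred ⊢
  have hΔI : IsUnit I.Δ := by
    rw [WeierstrassCurve.map_Δ] at hΔred
    by_contra hnot
    exact hΔred ((IsLocalRing.residue_eq_zero_iff _).mpr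
      ((IsLocalRing.mem_maximalIdeal _).mpr hnot))
  have hTq : IsTwoTorsionPt (E.baseChange ℚ_[q]) (algebraMap ℚ ℚ_[q] x₀) (algebraMap ℚ ℚ_[q] y₀) :=
    hT.map (algebraMap ℚ ℚ_[q])
  have hTC := hTq.variableChange C
  have hbC := hTq.linCoeff_variableChange C
  have hΔC := WeierstrassCurve.variableChange_Δ (E.baseChange ℚ_[q]) C
  rw [← hIW] at hTC hbC hΔC
  obtain ⟨X, Y, hXY, hX, hY⟩ := hTC.exists_integral hq2
  have hbI : IsUnit (linCoeff I X Y) := by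
    have := hΔI
    rw [hXY.Δ_eq, pow_two, mul_assoc] at this
    exact isUnit_of_mul_isUnit_left this
  have hu : (C.u : ℚ_[q]) ≠ 0 := C.u.ne_zero
  have hu' : ((C.u⁻¹ : ℚ_[q]ˣ) : ℚ_[q]) = (C.u : ℚ_[q])⁻¹ := Units.val_inv_eq_inv_val _
  refine ⟨I.Δ, linCoeff I X Y, (C.u : ℚ_[q]) ^ 6, (C.u : ℚ_[q]) ^ 2, hΔI, hbI,
    pow_ne_zero _ hu, pow_ne_zero _ hu, ?_, ?_, ?_⟩
  · have e1 : (I.baseChange ℚ_[q]).Δ = (I.Δ : ℚ_[q]) := by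
      rw [WeierstrassCurve.baseChange, WeierstrassCurve.map_Δ]; rfl
    have e2 : (E.baseChange ℚ_[q]).Δ = (E.Δ : ℚ_[q]) := by
      rw [WeierstrassCurve.baseChange, WeierstrassCurve.map_Δ, eq_ratCast]
    rw [e1, e2, hu'] at hΔC
    rw [hΔC]
    field_simp
  · have e1 : linCoeff (I.baseChange ℚ_[q]) (X : ℚ_[q]) (Y : ℚ_[q]) =
        ((linCoeff I X Y : ℤ_[q]) : ℚ_[q]) := linCoeff_map I X Y (algebraMap ℤ_[q] ℚ_[q])
    have e2 : linCoeff (E.baseChange ℚ_[q]) (algebraMap ℚ ℚ_[q] x₀) (algebraMap ℚ ℚ_[q] y₀) =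
        ((linCoeff E x₀ y₀ : ℚ) : ℚ_[q]) := by
      rw [← eq_ratCast (algebraMap ℚ ℚ_[q])]
      exact linCoeff_map E x₀ y₀ (algebraMap ℚ ℚ_[q])
    rw [← hX, ← hY, e1, e2, hu'] at hbC
    rw [hbC]
    field_simp
  · have hfin : Finite (IsLocalRing.ResidueField ℤ_[q]) :=
      Finite.of_equiv _ (PadicInt.residueField (p := q)).symm.toEquiv
    have h2 : (2 : IsLocalRing.ResidueField ℤ_[q]) ≠ 0 := by
      rw [← map_ofNat (IsLocalRing.residue ℤ_[q]) 2]
      exact ((isUnit_two_padicInt hq2).map _).ne_zero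
    have key := (hXY.map (IsLocalRing.residue ℤ_[q])).four_dvd_card_point_iff h2 hΔred
    rw [linCoeff_map, WeierstrassCurve.map_Δ] at key
    have hsq : ∀ w : ℤ_[q], IsSquare (IsLocalRing.residue ℤ_[q] w) ↔
        IsSquare (PadicInt.toZMod w) := by
      intro w
      have : PadicInt.toZMod w = PadicInt.residueField (IsLocalRing.residue ℤ_[q] w) := rfl
      rw [this]
      constructor
      · exact fun h ↦ h.map _
      · intro h
        have := h.map (PadicInt.residueField (p := q)).symm
        rwa [RingEquiv.symm_apply_apply] at this
    rw [hsq, hsq] at key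
    exact key

end Padic

/-! ### Combination of the local and global criteria -/

/-- With `N` the number of points of the reduction, `q` is inert in both quadratic fields if and only
if `N` is even and not divisible by `4`. -/
theorem isInertIn_and_isInertIn_iff {E E' : WeierstrassCurve ℚ} [E.IsElliptic] [E'.IsElliptic]
    (hquot : IsQuotientByRationalTwoTorsion E E') (htor : ConditionTor E E')
    {q : ℕ} [Fact q.Prime] (hq2 : q ≠ 2) (hgood : GoodReductionAt E q) :
    2 ∣ Nat.card ((minimalAt E q).reduction ℤ_[q]).toAffine.Point ∧
      (IsInertIn q (sqrtField E.Δ) ∧ IsInertIn q (sqrtField E'.Δ) ↔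
        ¬ 4 ∣ Nat.card ((minimalAt E q).reduction ℤ_[q]).toAffine.Point) := by
  obtain ⟨x₀, y₀, hns, hT, huniq⟩ := exists_twoTorsion_eq htor.1
  obtain ⟨x₁, y₁, hns', hT', huniq'⟩ := exists_twoTorsion_eq htor.2
  have hd := not_isSquare_Δ hT huniq
  have hd' := not_isSquare_Δ hT' huniq'
  obtain ⟨r, hr⟩ := isSquare_linCoeff_mul_Δ hquot hns hT huniq
  obtain ⟨δ, β, c, c', hδ, hβ, hc, hc', hΔ, hb, h2, h4⟩ :=
    exists_units_of_goodReduction hq2 hgood hT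
  have hb0 : linCoeff E x₀ y₀ ≠ 0 := hT.linCoeff_ne_zero E.isUnit_Δ.ne_zero
  have hr0 : r ≠ 0 := by
    rintro rfl
    rw [mul_zero] at hr
    exact mul_ne_zero hb0 E'.isUnit_Δ.ne_zero hr
  have hbq : ((linCoeff E x₀ y₀ : ℚ) : ℚ_[q]) ≠ 0 := by exact_mod_cast hb0
  have hrq : (r : ℚ_[q]) ≠ 0 := by exact_mod_cast hr0
  have hΔ' : (E'.Δ : ℚ_[q]) = β * (c' * r / (linCoeff E x₀ y₀ : ℚ)) ^ 2 := by
    have h := congrArg (Rat.cast : ℚ → ℚ_[q]) hr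
    push_cast at h
    rw [div_pow, mul_pow, ← mul_div_assoc, ← mul_assoc, ← hb, eq_div_iff (pow_ne_zero 2 hbq)]
    linear_combination ((linCoeff E x₀ y₀ : ℚ) : ℚ_[q]) * h
  refine ⟨h2, ?_⟩
  rw [h4, not_or, isInertIn_sqrtField_iff_toZMod hq2 hd hδ hc hΔ,
    isInertIn_sqrtField_iff_toZMod hq2 hd' hβ (div_ne_zero (mul_ne_zero hc' hrq) hbq) hΔ']

lemma isAdmissible_iff {E E' : WeierstrassCurve ℚ} [E.IsElliptic] [E'.IsElliptic]
    (htor : ConditionTor E E') {q : ℕ} [Fact q.Prime] (hq2 : q ≠ 2) (hgood : GoodReductionAt E q) :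
    IsAdmissible E q E' ↔ IsInertIn q (sqrtField E.Δ) ∧ IsInertIn q (sqrtField E'.Δ) := by
  obtain ⟨x₀, y₀, -, hT, -⟩ := exists_twoTorsion_eq htor.1
  obtain ⟨x₁, y₁, -, hT', -⟩ := exists_twoTorsion_eq htor.2
  rw [IsAdmissible, twoDivisionField_eq_sqrtField hT, twoDivisionField_eq_sqrtField hT']
  exact ⟨fun h ↦ h.2.2, fun h ↦ ⟨hq2, hgood, h⟩⟩

lemma legendreSym_neg_one_eq {q : ℕ} [Fact q.Prime] (hq2 : q ≠ 2) :
    (q % 4 = 1 ∧ legendreSym q (-1) = 1) ∨ (q % 4 = 3 ∧ legendreSym q (-1) = -1) := by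
  rw [legendreSym.at_neg_one hq2]
  have hodd := (Fact.out : q.Prime).eq_two_or_odd.resolve_left hq2
  have : q % 4 = 1 ∨ q % 4 = 3 := by omega
  rcases this with h | h
  · exact Or.inl ⟨h, ZMod.χ₄_nat_one_mod_four h⟩
  · exact Or.inr ⟨h, ZMod.χ₄_nat_three_mod_four h⟩

end EllHecke

end

theorem mainTheorem7 (E E' : WeierstrassCurve ℚ) [E.IsElliptic] [E'.IsElliptic]
    (hquot : EllHecke.IsQuotientByRationalTwoTorsion E E')
    (htor : EllHecke.ConditionTor E E')
    (q : ℕ) [Fact q.Prime] (hq2 : q ≠ 2) (hgood : EllHecke.GoodReductionAt E q) :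
    ((q ≡ 1 [MOD 4] ∧ EllHecke.IsInertIn q (EllHecke.sqrtField E.Δ) ∧
          EllHecke.IsInertIn q (EllHecke.sqrtField E'.Δ) →
        EllHecke.traceOfFrobenius E q ≡ 0 [ZMOD 4]) ∧
      (q ≡ 3 [MOD 4] ∧ (EllHecke.SplitsIn q (EllHecke.sqrtField E.Δ) ∨
          EllHecke.SplitsIn q (EllHecke.sqrtField E'.Δ)) →
        EllHecke.traceOfFrobenius E q ≡ 0 [ZMOD 4]) ∧
      (q ≡ 1 [MOD 4] ∧ (EllHecke.SplitsIn q (EllHecke.sqrtField E.Δ) ∨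
          EllHecke.SplitsIn q (EllHecke.sqrtField E'.Δ)) →
        EllHecke.traceOfFrobenius E q ≡ 2 [ZMOD 4]) ∧
      (q ≡ 3 [MOD 4] ∧ EllHecke.IsInertIn q (EllHecke.sqrtField E.Δ) ∧
          EllHecke.IsInertIn q (EllHecke.sqrtField E'.Δ) →
        EllHecke.traceOfFrobenius E q ≡ 2 [ZMOD 4])) ∧
    (EllHecke.IsAdmissible E q E' ↔
      EllHecke.IsInertIn q (EllHecke.sqrtField E.Δ) ∧
        EllHecke.IsInertIn q (EllHecke.sqrtField E'.Δ)) ∧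
    (EllHecke.IsAdmissible E q E' ↔
      EllHecke.traceOfFrobenius E q ≡ 1 - legendreSym q (-1) [ZMOD 4]) := by
  obtain ⟨h2, hin⟩ := EllHecke.isInertIn_and_isInertIn_iff hquot htor hq2 hgood
  have hadm := EllHecke.isAdmissible_iff htor hq2 hgood
  have hsplit : EllHecke.SplitsIn q (EllHecke.sqrtField E.Δ) ∨
      EllHecke.SplitsIn q (EllHecke.sqrtField E'.Δ) →
      ¬ (EllHecke.IsInertIn q (EllHecke.sqrtField E.Δ) ∧
        EllHecke.IsInertIn q (EllHecke.sqrtField E'.Δ)) := by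
    have hq0 : q ≠ 0 := (Fact.out : q.Prime).ne_zero
    rintro (h | h) ⟨h1, h1'⟩
    · exact h.not_isInertIn hq0 h1
    · exact h.not_isInertIn hq0 h1'
  rw [hin] at hsplit
  have hleg := EllHecke.legendreSym_neg_one_eq hq2
  refine ⟨⟨?_, ?_, ?_, ?_⟩, hadm, ?_⟩
  · rintro ⟨hq, h⟩
    rw [hin] at h
    simp only [EllHecke.traceOfFrobenius, Nat.ModEq, Int.ModEq] at hq ⊢
    omega
  · rintro ⟨hq, h⟩
    have := hsplit h
    simp only [EllHecke.traceOfFrobenius, Nat.ModEq, Int.ModEq] at hq ⊢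
    omega
  · rintro ⟨hq, h⟩
    have := hsplit h
    simp only [EllHecke.traceOfFrobenius, Nat.ModEq, Int.ModEq] at hq ⊢
    omega
  · rintro ⟨hq, h⟩
    rw [hin] at h
    simp only [EllHecke.traceOfFrobenius, Nat.ModEq, Int.ModEq] at hq ⊢
    omega
  · rw [hadm, hin]
    simp only [EllHecke.traceOfFrobenius, Int.ModEq]
    rcases hleg with ⟨hq, h⟩ | ⟨hq, h⟩ <;> rw [h] <;> omega
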